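/- Let $p,q\in(0,1)$, $\mu>0$ and $0<\lambda_b<\lambda_g$. Consider a status-updating system with a single server that uses a blocking policy: a packet that arrives when the server is idle enters service at once (it is then called successful), and a packet that arrives when the server is busy is discarded. Successful packets are numbered $j=0,1,2,\dots$, and packet $0$ arrives at time $0$. The service times $S_j$ are i.i.d. exponential with rate $\mu$. The sampler has a state $J\in\{b,g\}$, which can change only when a packet enters service: its values $J_0,J_1,\dots$ right after the successive entries into service form a Markov chain with transition matrix $P=\begin{pmatrix}1-p&p\\q&1-q\end{pmatrix}$ (states ordered $b,g$) and arbitrary initial law. While the state is $s\in\{b,g\}$, the interarrival times are exponential with rate $\lambda_s$. All service times and interarrival times are mutually independent, and they are independent of the chain $(J_j)$. Let $T_j$ be the arrival time of the $j$-th successful packet ($T_0=0$), let $Y_j=T_{j+1}-T_j$ be the $j$-th update cycle, and let $Z_j=Y_j-S_j$ be the idle waiting time of the server in it. Packet $j$ is delivered to the monitor at time $T_j+S_j$. The age is $\Delta(t)=t-u(t)$, where $u(t)$ is the generation time of the most recent packet delivered by time $t$; before the first delivery $u(t)=-a_0$, with a fixed $a_0\ge 0$. Let $Q_j$ be the area of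 the part of the region under the age curve that belongs to cycle $j$, that is, the area of $\{(t,a): 0\le a\le\Delta(t),\ T_j\le t-a<T_{j+1}\}$. For $s\in\{b,g\}$ let $S$ and $Z_s$ be independent exponential variables with rates $\mu$ and $\lambda_s$, and put $$E[Y_s]=E[S]+E[Z_s],\qquad E[Q_s]=\tfrac12E[(S+Z_s)^2]+E[S]^2+E[S]\,E[Z_s],$$ which do not depend on $p$ or $q$. Let $$\Delta=\frac{q\,E[Q_b]+p\,E[Q_g]}{q\,E[Y_b]+p\,E[Y_g]}.$$ Then the following hold. 1. Almost surely, $t\mapsto\Delta(t)$ is integrable on $[0,\tau]$ for every $\tau\ge0$, and $$\lim_{\tau\to\infty}\frac1\tau\int_0^\tau\Delta(t)\,dt=\Delta,\qquad \lim_{n\to\infty}\frac{\frac1n\sum_{j<n}Q_j}{\frac1n\sum_{j<n}Y_j}=\Delta.$$ 2. For every $j$ and every $s\in\{b,g\}$ with $P(J_j=s)>0$, conditionally on $J_j=s$ the pair $(S_j,Z_j)$ has the law of $(S,Z_s)$, the variables $Y_j$ and $Q_j$ are integrable, and their conditional means are $E[Y_s]$ and $E[Q_s]$. 3. If the chain is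 stationary, i.e. $P(J_0=b)=\frac{q}{p+q}$, then for every $j$ the variables $Y_j$ and $Q_j$ are integrable and $E[Q_j]/E[Y_j]=\Delta$. -/

import Mathlib

open MeasureTheory ProbabilityTheory Filter Topology

namespace GilbertElliot

/-- The transition matrix of the two-state chain; state `0` is the bad state, `1` the good state. -/
def transitionMatrix (p q : ℝ) : Matrix (Fin 2) (Fin 2) ℝ :=
  !![1 - p, p; q, 1 - q]

/-- `J` is a Markov chain on `Fin 2` with transition matrix `A` (arbitrary initial law). -/
def IsMarkovChain {Ω : Type*} [MeasurableSpace Ω] (Pr : Measure Ω)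
    (A : Matrix (Fin 2) (Fin 2) ℝ) (J : ℕ → Ω → Fin 2) : Prop :=
  (∀ j, Measurable (J j)) ∧
    ∀ (n : ℕ) (s : ℕ → Fin 2),
      Pr.real {ω | ∀ i ≤ n + 1, J i ω = s i} =
        Pr.real {ω | ∀ i ≤ n, J i ω = s i} * A (s n) (s (n + 1))

/-- The random inputs of the system. Successful packets (those that enter service) are numbered
`j = 0, 1, 2, …`.
* `state j` is the sampler's state after packet `j` has entered service, kept until the next
  packet enters service;
* `service j` is the service time of successful packet `j`;
* `gap s j k` is the `k`-th (`k = 0, 1, …`) interarrival time after the entry of successful packet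
  `j` into service, if the sampler is then in state `s`. -/
structure SamplingSystem (Ω : Type*) where
  state : ℕ → Ω → Fin 2
  service : ℕ → Ω → ℝ
  gap : Fin 2 → ℕ → ℕ → Ω → ℝ

namespace SamplingSystem

variable {Ω : Type*} (M : SamplingSystem Ω)

/-- All service times and interarrival times, as one family. -/
def times : ℕ ⊕ (Fin 2 × ℕ × ℕ) → Ω → ℝ
  | Sum.inl j => M.service j
  | Sum.inr i => M.gap i.1 i.2.1 i.2.2

/-- The probabilistic assumptions: the states form a Markov chain, service times are exponential
with rate `μ`, interarrival times in state `0` (bad) and `1` (good) are exponential with rates `lb`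
and `lg`; all these times are mutually independent, and independent of the chain. -/
structure IsGilbertElliot [MeasurableSpace Ω] (Pr : Measure Ω) (p q μ lb lg : ℝ) : Prop where
  chain : IsMarkovChain Pr (transitionMatrix p q) M.state
  measurable_times : ∀ i, Measurable (M.times i)
  service_law : ∀ j, Pr.map (M.service j) = expMeasure μ
  gap_law_bad : ∀ j k, Pr.map (M.gap 0 j k) = expMeasure lb
  gap_law_good : ∀ j k, Pr.map (M.gap 1 j k) = expMeasure lg
  indep_times : iIndepFun M.times Pr
  indep_chain : IndepFun (fun ω j => M.state j ω) (fun ω i => M.times i ω) Pr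

/-- Time from the entry of successful packet `j` into service until the arrival of the
`(k + 1)`-st packet generated after it. -/
noncomputable def arrival (j k : ℕ) (ω : Ω) : ℝ :=
  ∑ i ∈ Finset.range (k + 1), M.gap (M.state j ω) j i ω

/-- Index of the first packet that, after successful packet `j`, finds the server idle; the packets
arriving earlier find the server busy and are discarded. -/
noncomputable def nextSuccess (j : ℕ) (ω : Ω) : ℕ :=
  sInf {k | M.service j ω ≤ M.arrival j k ω}

/-- The update cycle `Y`: time between successive successful arrivals `j` and `j + 1`. -/
noncomputable def cycle (j : ℕ) (ω : Ω) : ℝ :=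
  M.arrival j (M.nextSuccess j ω) ω

/-- The idle waiting time `Z` of the server in cycle `j`. -/
noncomputable def waiting (j : ℕ) (ω : Ω) : ℝ :=
  M.cycle j ω - M.service j ω

/-- Generation time (time-stamp) of successful packet `j`; packet `0` is generated at time `0`. -/
noncomputable def genTime (j : ℕ) (ω : Ω) : ℝ :=
  ∑ i ∈ Finset.range j, M.cycle i ω

/-- Time at which successful packet `j` is delivered to the monitor. -/
noncomputable def delivery (j : ℕ) (ω : Ω) : ℝ :=
  M.genTime j ω + M.service j ω

/-- Time-stamp of the most recent update at the monitor at time `t`; before the first delivery the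
monitor holds an update with time-stamp `-a₀`. -/
noncomputable def timestamp (a₀ t : ℝ) (ω : Ω) : ℝ :=
  sSup (insert (-a₀) {u | ∃ j, M.delivery j ω ≤ t ∧ u = M.genTime j ω})

/-- The age of information at time `t`. -/
noncomputable def age (a₀ t : ℝ) (ω : Ω) : ℝ :=
  t - M.timestamp a₀ t ω

/-- The area `Q` under the age curve that belongs to update cycle `j`: the part of the region under
the curve between the lines of slope one starting on the time axis at the two ends of the cycle. -/
noncomputable def area (a₀ : ℝ) (j : ℕ) (ω : Ω) : ℝ :=
  (volume : Measure (ℝ × ℝ)).real {x | 0 ≤ x.2 ∧ x.2 ≤ M.age a₀ x.1 ω ∧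
    M.genTime j ω ≤ x.1 - x.2 ∧ x.1 - x.2 < M.genTime (j + 1) ω}

end SamplingSystem

/-- `E[S] + E[Z]` for `S`, `Z` exponential with rates `μ`, `l`. -/
noncomputable def meanCycle (μ l : ℝ) : ℝ :=
  (∫ s, s ∂expMeasure μ) + ∫ z, z ∂expMeasure l

/-- `E[(S + Z)²] / 2 + E[S]² + E[S] E[Z]` for independent `S`, `Z`, exponential with rates
`μ`, `l`. -/
noncomputable def meanArea (μ l : ℝ) : ℝ :=
  (1 / 2) * (∫ x : ℝ × ℝ, (x.1 + x.2) ^ 2 ∂(expMeasure μ).prod (expMeasure l))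
    + (∫ s, s ∂expMeasure μ) ^ 2 + (∫ s, s ∂expMeasure μ) * ∫ z, z ∂expMeasure l

/-- `(q E[Q_b] + p E[Q_g]) / (q E[Y_b] + p E[Y_g])`. -/
noncomputable def averageAge (p q μ lb lg : ℝ) : ℝ :=
  (q * meanArea μ lb + p * meanArea μ lg) / (q * meanCycle μ lb + p * meanCycle μ lg)

end GilbertElliot

namespace GilbertElliot

/-! The dependence on the chain is separated from the dependence on the times. For each state `s`,
`cycleIn s j` is the length cycle `j` would have in state `s`. It is a function of the times alone,
hence independent of the whole chain, and the true cycle is `∑ s, stateInd s j * cycleIn s j`.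

Within a fixed state the cycle is the first passage of a random walk with exponential steps over an
independent service time. By lack of memory (`map_overshoot`) the overshoot is exponential and
independent of the service time, so `cycleIn s j` is distributed as `S + Z_s`. A shear of the plane
gives the pathwise identity `Q_j = Y_j² / 2 + Y_j S_{j+1}` (`area_eq`). Since `S_{j+1}` is
independent of `cycleIn s j`, taking means yields `meanArea`. Conditioning on the state does not
affect functions of the times, which gives the per-state claims.

Every almost sure limit, except the unboundedness of the walks, rests on one law of large numbers
for orthogonal sequences with bounded second moments (`ae_tendsto_average_of_orthogonal`) or on the
summability argument behind it. Applied to the centred transitions of the chain, it shows that the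
states have frequencies `q / (p + q)` and `p / (p + q)`. Applied to centred functions of the times
multiplied by state indicators, it shows that the averages of `Y_j` and `Q_j` converge to the
stationary means, whose ratio is `averageAge`.

Finally, the integral of the age up to the `n`-th delivery is the sum of the first `n` areas plus
boundary terms of order `o(n)` (`integral_age_delivery`). Monotonicity of the integral interpolates
between deliveries (`tendsto_timeAverage`). -/

/-! ### The exponential distribution -/

lemma expMeasure_Ici {r x : ℝ} (hr : 0 < r) (hx : 0 ≤ x) :
    expMeasure r (Set.Ici x) = ENNReal.ofReal (Real.exp (-(r * x))) := by
  have := isProbabilityMeasure_expMeasure hr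
  have hae : (Set.Ioi x : Set ℝ) =ᵐ[expMeasure r] Set.Ici x :=
    (withDensity_absolutelyContinuous _ _).ae_eq Ioi_ae_eq_Ici
  rw [measure_congr hae.symm, ← Set.compl_Iic,
    prob_compl_eq_one_sub measurableSet_Iic, ← ofReal_cdf, cdf_expMeasure_eq hr, if_pos hx,
    ← ENNReal.ofReal_one, ← ENNReal.ofReal_sub _ (by
      rw [sub_nonneg, Real.exp_le_one_iff]; nlinarith)]
  congr 1; ring

lemma expMeasure_Ici_of_nonpos {r x : ℝ} (hr : 0 < r) (hx : x ≤ 0) :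
    expMeasure r (Set.Ici x) = 1 := by
  have := isProbabilityMeasure_expMeasure hr
  refine le_antisymm prob_le_one ?_
  calc (1 : ENNReal) = expMeasure r (Set.Ici 0) := by rw [expMeasure_Ici hr le_rfl]; simp
    _ ≤ _ := measure_mono (Set.Ici_subset_Ici.2 hx)

lemma ae_pos_expMeasure {r : ℝ} (hr : 0 < r) : ∀ᵐ x ∂expMeasure r, 0 < x := by
  have := isProbabilityMeasure_expMeasure hr
  have h : expMeasure r (Set.Iic 0) = 0 := by
    rw [← ofReal_cdf, cdf_expMeasure_eq hr]; simp
  rw [ae_iff]; simpa [Set.Iic] using h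

lemma integrable_pow_expMeasure {r : ℝ} (hr : 0 < r) (n : ℕ) :
    Integrable (fun x : ℝ => x ^ n) (expMeasure r) := by
  have hm : Measurable (gammaPDF 1 r) := (measurable_gammaPDFReal 1 r).ennreal_ofReal
  have h0 := (integrableOn_rpow_mul_exp_neg_mul_rpow (p := 1) (s := n) (b := r)
    (by have : (0 : ℝ) ≤ n := n.cast_nonneg
        linarith) one_pos hr).const_mul r
  have h1 : IntegrableOn (fun x : ℝ => x ^ n * (gammaPDF 1 r x).toReal) (Set.Ioi 0) := by
    refine IntegrableOn.congr_fun h0 (fun x hx => ?_) measurableSet_Ioi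
    have hx' : (0 : ℝ) ≤ x := le_of_lt hx
    change r * (x ^ (n : ℝ) * Real.exp (-r * x ^ (1 : ℝ))) = x ^ n * (exponentialPDF r x).toReal
    rw [exponentialPDF_of_nonneg hx', ENNReal.toReal_ofReal (by positivity)]
    simp only [Real.rpow_natCast, Real.rpow_one, neg_mul]
    ring
  have h2 : IntegrableOn (fun x : ℝ => x ^ n * (gammaPDF 1 r x).toReal) (Set.Iio 0) := by
    refine integrableOn_zero.congr_fun (fun x hx => ?_) measurableSet_Iio
    simp [gammaPDF_of_neg hx]
  unfold expMeasure gammaMeasure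
  rw [integrable_withDensity_iff hm (Eventually.of_forall fun x => ENNReal.ofReal_lt_top),
    ← integrableOn_univ, ← Set.Iio_union_Ici (a := (0 : ℝ))]
  exact h2.union ((integrableOn_Ici_iff_integrableOn_Ioi (by finiteness)).2 h1)

lemma integrable_id_expMeasure {r : ℝ} (hr : 0 < r) : Integrable (fun x : ℝ => x) (expMeasure r) := by
  simpa using integrable_pow_expMeasure hr 1

lemma integral_expMeasure_pos {r : ℝ} (hr : 0 < r) : 0 < ∫ x, x ∂expMeasure r := by
  have := isProbabilityMeasure_expMeasure hr
  have h := ae_pos_expMeasure hr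
  rw [integral_pos_iff_support_of_nonneg_ae (h.mono fun x hx => hx.le) (integrable_id_expMeasure hr)]
  have : expMeasure r (Function.support fun x : ℝ => x) = 1 := by
    rw [prob_compl_eq_zero_iff₀ _ |>.symm]
    · exact measure_mono_null (fun x hx => by simpa using hx) (ae_iff.1 (h.mono fun x hx => hx.ne'))
    · exact (measurableSet_eq_fun measurable_id measurable_const).compl.nullMeasurableSet
  rw [this]; exact one_pos

/-! ### First passage and the memoryless property -/

/-- The first partial sum `g 0 + ⋯ + g k` of the sequence `g` that is at least `s`. -/
noncomputable def firstPassage (s : ℝ) (g : ℕ → ℝ) : ℝ :=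
  ∑ i ∈ Finset.range (sInf {k | s ≤ ∑ i ∈ Finset.range (k + 1), g i} + 1), g i

/-- Existence of a passage is essential: since `sInf ∅ = 0`, the first passage of a walk that never
reaches `s` would be `g 0`. -/
lemma le_firstPassage {s : ℝ} {g : ℕ → ℝ} (h : ∃ k, s ≤ ∑ i ∈ Finset.range (k + 1), g i) :
    s ≤ firstPassage s g :=
  Nat.sInf_mem (s := {k | s ≤ ∑ i ∈ Finset.range (k + 1), g i}) h

lemma firstPassage_eq {s : ℝ} {g : ℕ → ℝ} {k : ℕ} (h : s ≤ ∑ i ∈ Finset.range (k + 1), g i)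
    (hlt : ∀ i < k, ∑ i ∈ Finset.range (i + 1), g i < s) :
    firstPassage s g = ∑ i ∈ Finset.range (k + 1), g i := by
  have : sInf {k | s ≤ ∑ i ∈ Finset.range (k + 1), g i} = k := by
    refine le_antisymm (Nat.sInf_le h) ?_
    by_contra! hk
    exact absurd (Nat.sInf_mem (s := {k | s ≤ ∑ i ∈ Finset.range (k + 1), g i}) ⟨k, h⟩)
      (not_le.2 (hlt _ hk))
  rw [firstPassage, this]

lemma measurable_firstPassage {α : Type*} [MeasurableSpace α] {s : α → ℝ} {g : ℕ → α → ℝ}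
    (hs : Measurable s) (hg : ∀ i, Measurable (g i)) :
    Measurable fun a => firstPassage (s a) (fun i => g i a) := by
  have hA : ∀ k, Measurable fun a => ∑ i ∈ Finset.range k, g i a :=
    fun k => Finset.measurable_sum _ fun i _ => hg i
  have hE : ∀ k, MeasurableSet {a | s a ≤ ∑ i ∈ Finset.range (k + 1), g i a} :=
    fun k => measurableSet_le hs (hA _)
  have hN : Measurable fun a => sInf {k | s a ≤ ∑ i ∈ Finset.range (k + 1), g i a} := by
    refine measurable_of_Ioi fun n => ?_
    -- The union excludes the points where the level is never reached; there the infimum is `0` and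
    -- not large.
    have : (fun a => sInf {k | s a ≤ ∑ i ∈ Finset.range (k + 1), g i a}) ⁻¹' Set.Ioi n =
        (⋂ k ≤ n, {a | s a ≤ ∑ i ∈ Finset.range (k + 1), g i a}ᶜ) ∩
          ⋃ k, {a | s a ≤ ∑ i ∈ Finset.range (k + 1), g i a} := by
      ext a
      simp only [Set.mem_preimage, Set.mem_Ioi, Set.mem_inter_iff, Set.mem_iInter, Set.mem_iUnion,
        Set.mem_compl_iff]
      constructor
      · intro h
        refine ⟨fun k hk hk' => absurd (h.trans_le (Nat.sInf_le hk')) (by omega), ?_⟩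
        obtain ⟨k, hk⟩ := Nat.nonempty_of_pos_sInf (Nat.zero_lt_of_lt h)
        exact ⟨k, hk⟩
      · rintro ⟨h, k, hk⟩
        by_contra! hn
        exact h _ hn (Nat.sInf_mem (s := {k | s a ≤ ∑ i ∈ Finset.range (k + 1), g i a}) ⟨k, hk⟩)
    rw [this]
    exact (MeasurableSet.biInter (Set.to_countable _) fun k _ => (hE k).compl).inter
      (MeasurableSet.iUnion hE)
  have hF : Measurable fun x : ℕ × α => ∑ i ∈ Finset.range (x.1 + 1), g i x.2 :=
    measurable_from_prod_countable_right fun k => hA (k + 1)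
  exact hF.comp (hN.prodMk measurable_id)

/-- One step of lack of memory. Given the past `m`, the conditional probability of `U + z ≤ G` is
`exp (-l (U + z))` on `C`, and the factor `exp (-l z)` comes out of the integral. Nonnegativity of
`U` on `C` keeps the tail formula valid. -/
lemma measure_exp_shift {Ω : Type*} {m mΩ : MeasurableSpace Ω} {P : Measure Ω} [IsProbabilityMeasure P]
    {l : ℝ} (hl : 0 < l) (hm : m ≤ mΩ) {G U : Ω → ℝ} {C : Set Ω}
    (hG : Measurable G) (hGl : P.map G = expMeasure l)
    (hind : Indep m (MeasurableSpace.comap G inferInstance) P)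
    (hU : Measurable[m] U) (hC : MeasurableSet[m] C) (hUC : ∀ ω ∈ C, 0 ≤ U ω)
    {z : ℝ} (hz : 0 ≤ z) :
    P (C ∩ {ω | U ω + z ≤ G ω}) =
      ENNReal.ofReal (Real.exp (-(l * z))) * P (C ∩ {ω | U ω ≤ G ω}) := by
  have := isProbabilityMeasure_expMeasure hl
  classical
  -- Level and event are packed into one `m`-measurable variable, so that independence from `G`
  -- becomes a product law.
  set X : Ω → ℝ × Prop := fun ω => (U ω, ω ∈ C) with hX
  have hXm : Measurable[m] X := hU.prodMk ((@measurable_mem Ω C m).2 hC)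
  have hX0 : Measurable X := hXm.mono hm le_rfl
  have hXG : IndepFun X G P := by
    rw [IndepFun_iff_Indep]
    exact indep_of_indep_of_le_left hind hXm.comap_le
  have hmap := (indepFun_iff_map_prod_eq_prod_map_map hX0.aemeasurable hG.aemeasurable).1 hXG
  have hset : ∀ w : ℝ, MeasurableSet {x : (ℝ × Prop) × ℝ | x.1.2 ∧ x.1.1 + w ≤ x.2} := fun w =>
    (measurableSet_setOfPred.2 (measurable_snd.comp measurable_fst)).inter
      (measurableSet_le (f := fun x : (ℝ × Prop) × ℝ => x.1.1 + w) (g := fun x => x.2)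
        (by fun_prop) (by fun_prop))
  have key : ∀ w : ℝ, 0 ≤ w → P (C ∩ {ω | U ω + w ≤ G ω}) =
      ENNReal.ofReal (Real.exp (-(l * w))) *
        ∫⁻ x in {x : ℝ × Prop | x.2}, ENNReal.ofReal (Real.exp (-(l * x.1))) ∂(P.map X) := by
    intro w hw
    have h1 : P (C ∩ {ω | U ω + w ≤ G ω}) =
        (P.map fun ω => (X ω, G ω)) {x : (ℝ × Prop) × ℝ | x.1.2 ∧ x.1.1 + w ≤ x.2} := by
      rw [Measure.map_apply (hX0.prodMk hG) (hset w)]; rfl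
    have hp : MeasurableSet {x : ℝ × Prop | x.2} := measurableSet_setOfPred.2 measurable_snd
    rw [h1, hmap, hGl, Measure.prod_apply (hset w), ← lintegral_const_mul _ (by fun_prop),
      ← lintegral_indicator hp]
    refine lintegral_congr_ae ?_
    have hae : ∀ᵐ x ∂(P.map X), x.2 → 0 ≤ x.1 := by
      rw [ae_map_iff hX0.aemeasurable]
      · exact Eventually.of_forall hUC
      · exact measurableSet_setOfPred.2 ((measurable_snd).imp
          (measurableSet_setOfPred.1 (measurableSet_le measurable_const measurable_fst)))
    filter_upwards [hae] with x hx
    by_cases h : x.2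
    · rw [Set.indicator_of_mem (by exact h)]
      have : Prod.mk x ⁻¹' {x : (ℝ × Prop) × ℝ | x.1.2 ∧ x.1.1 + w ≤ x.2} = Set.Ici (x.1 + w) := by
        ext y; simp [h]
      rw [this, expMeasure_Ici hl (add_nonneg (hx h) hw), ← ENNReal.ofReal_mul (Real.exp_pos _).le,
        ← Real.exp_add]
      congr 2; ring
    · rw [Set.indicator_of_notMem (by exact h)]
      have : Prod.mk x ⁻¹' {x : (ℝ × Prop) × ℝ | x.1.2 ∧ x.1.1 + w ≤ x.2} = ∅ := by
        ext y; simp [h]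
      simp [this]
  have h0 := key 0 le_rfl
  simp only [add_zero, mul_zero, neg_zero, Real.exp_zero, ENNReal.ofReal_one, one_mul] at h0
  rw [key z hz, h0]

/-- Memoryless property: the overshoot of a random walk with exponential steps over an independent
nonnegative level is exponential and independent of the level. -/
theorem map_overshoot {Ω : Type*} {mΩ : MeasurableSpace Ω} {P : Measure Ω} [IsProbabilityMeasure P]
    {l : ℝ} (hl : 0 < l) {m : ℕ → MeasurableSpace Ω} (hm : ∀ k, m k ≤ mΩ)
    {S : Ω → ℝ} {G : ℕ → Ω → ℝ} (hG : ∀ k, Measurable (G k)) (hGl : ∀ k, P.map (G k) = expMeasure l)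
    (hSm : ∀ k, Measurable[m k] S) (hGm : ∀ k, ∀ i < k, Measurable[m k] (G i))
    (hind : ∀ k, Indep (m k) (MeasurableSpace.comap (G k) inferInstance) P)
    (hS0 : ∀ᵐ ω ∂P, 0 ≤ S ω) (hex : ∀ᵐ ω ∂P, ∃ k, S ω ≤ ∑ i ∈ Finset.range (k + 1), G i ω) :
    P.map (fun ω => (S ω, firstPassage (S ω) (fun i => G i ω) - S ω)) =
      (P.map S).prod (expMeasure l) := by
  have := isProbabilityMeasure_expMeasure hl
  have hS : Measurable S := (hSm 0).mono (hm 0) le_rfl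
  have hY := measurable_firstPassage hS hG
  have hZ : Measurable fun ω => firstPassage (S ω) (fun i => G i ω) - S ω := hY.sub hS
  have : IsProbabilityMeasure (P.map S) := Measure.isProbabilityMeasure_map hS.aemeasurable
  have key : ∀ B : Set ℝ, MeasurableSet B → ∀ z : ℝ, 0 ≤ z →
      P (S ⁻¹' B ∩ {ω | z ≤ firstPassage (S ω) (fun i => G i ω) - S ω}) =
        ENNReal.ofReal (Real.exp (-(l * z))) * P (S ⁻¹' B) := by
    intro B hB
    -- On `C k` the walk has not reached the level after `k` steps, and `U k` is the height still
    -- missing. Passage at step `k` with overshoot at least `z` is then `U k + z ≤ G k`, and these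
    -- events are disjoint in `k`.
    let C : ℕ → Set Ω := fun k =>
      S ⁻¹' (B ∩ Set.Ici 0) ∩ ⋂ i, ⋂ (_ : i < k), {ω | ∑ i ∈ Finset.range (i + 1), G i ω < S ω}
    let U : ℕ → Ω → ℝ := fun k ω => S ω - ∑ i ∈ Finset.range k, G i ω
    have hA : ∀ k n, n ≤ k → Measurable[m k] fun ω => ∑ i ∈ Finset.range n, G i ω :=
      fun k n hn => Finset.measurable_sum _ fun i hi =>
        hGm k i (lt_of_lt_of_le (Finset.mem_range.1 hi) hn)
    have hC : ∀ k, MeasurableSet[m k] (C k) := fun k =>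
      MeasurableSet.inter (hSm k (hB.inter measurableSet_Ici))
        (MeasurableSet.iInter fun i => MeasurableSet.iInter fun hi =>
          measurableSet_lt (hA k (i + 1) hi) (hSm k))
    have hU : ∀ k, Measurable[m k] (U k) := fun k => (hSm k).sub (hA k k le_rfl)
    have hUC : ∀ k, ∀ ω ∈ C k, 0 ≤ U k ω := by
      intro k ω hω
      rcases k with _ | k
      · simpa [U] using hω.1.2
      · have := Set.mem_iInter₂.1 hω.2 k (Nat.lt_succ_self k)
        exact sub_nonneg.2 (le_of_lt this)
    have hdisj : ∀ z, 0 ≤ z →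
        Pairwise (Function.onFun Disjoint fun k => C k ∩ {ω | U k ω + z ≤ G k ω}) := by
      intro z hz
      have aux : ∀ i j, i < j → Disjoint (C i ∩ {ω | U i ω + z ≤ G i ω})
          (C j ∩ {ω | U j ω + z ≤ G j ω}) := by
        intro i j hij
        refine Set.disjoint_left.2 fun ω h1 h2 => ?_
        have h3 := Set.mem_iInter₂.1 h2.1.2 i hij
        have h4 : U i ω + z ≤ G i ω := h1.2
        simp only [Set.mem_ofPred_eq, Finset.sum_range_succ] at h3
        simp only [U] at h4
        linarith
      intro i j hij
      rcases lt_or_gt_of_ne hij with h | h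
      · exact aux i j h
      · exact (aux j i h).symm
    have hae : ∀ z, 0 ≤ z → P (S ⁻¹' B ∩ {ω | z ≤ firstPassage (S ω) (fun i => G i ω) - S ω}) =
        ∑' k, P (C k ∩ {ω | U k ω + z ≤ G k ω}) := by
      intro z hz
      rw [← measure_iUnion (hdisj z hz) fun k => ((hm k) _ (hC k)).inter
        (measurableSet_le (((hU k).mono (hm k) le_rfl).add_const z) (hG k))]
      refine measure_congr ?_
      filter_upwards [hS0, hex] with ω h0 hk
      refine propext ?_
      change (S ω ∈ B ∧ z ≤ firstPassage (S ω) (fun i => G i ω) - S ω) ↔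
        ω ∈ ⋃ k, C k ∩ {ω | U k ω + z ≤ G k ω}
      classical
      have hlt : ∀ i < Nat.find hk, ∑ i ∈ Finset.range (i + 1), G i ω < S ω :=
        fun i hi => not_le.1 (Nat.find_min hk hi)
      rw [Set.mem_iUnion]
      constructor
      · rintro ⟨hb, hzY⟩
        rw [firstPassage_eq (Nat.find_spec hk) hlt, Finset.sum_range_succ] at hzY
        refine ⟨Nat.find hk, ⟨⟨hb, h0⟩, Set.mem_iInter₂.2 hlt⟩, ?_⟩
        simp only [Set.mem_ofPred_eq, U]
        linarith
      · rintro ⟨k, ⟨hb, hi⟩, hzU⟩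
        refine ⟨hb.1, ?_⟩
        simp only [Set.mem_ofPred_eq, U] at hzU
        have hi' : ∀ i < k, ∑ i ∈ Finset.range (i + 1), G i ω < S ω :=
          fun i hik => by simpa using Set.mem_iInter₂.1 hi i hik
        rw [firstPassage_eq (k := k) (by rw [Finset.sum_range_succ]; linarith) hi',
          Finset.sum_range_succ]
        linarith
    have hzero : ∀ z, 0 ≤ z →
        P (S ⁻¹' B ∩ {ω | z ≤ firstPassage (S ω) (fun i => G i ω) - S ω}) =
        ENNReal.ofReal (Real.exp (-(l * z))) * ∑' k, P (C k ∩ {ω | U k ω ≤ G k ω}) := by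
      intro z hz
      rw [hae z hz, ← ENNReal.tsum_mul_left]
      exact tsum_congr fun k =>
        measure_exp_shift hl (hm k) (hG k) (hGl k) (hind k) (hU k) (hC k) (hUC k) hz
    intro z hz
    rw [hzero z hz]
    -- The series over passage steps does not depend on `z`. At `z = 0` it equals `P (S ⁻¹' B)`,
    -- because passage is almost sure, so it need not be computed.
    have h0 := hzero 0 le_rfl
    simp only [mul_zero, neg_zero, Real.exp_zero, ENNReal.ofReal_one, one_mul] at h0
    rw [← h0]
    congr 1
    refine measure_congr ?_
    filter_upwards [hex] with ω hk
    refine propext ⟨fun h => h.1, fun h => ⟨h, sub_nonneg.2 (le_firstPassage hk)⟩⟩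
  have hB : ∀ B : Set ℝ, MeasurableSet B →
      (P.restrict (S ⁻¹' B)).map (fun ω => firstPassage (S ω) (fun i => G i ω) - S ω) =
        P (S ⁻¹' B) • expMeasure l := by
    intro B hB
    refine Measure.ext_of_Ici _ _ fun z => ?_
    rw [Measure.map_apply hZ measurableSet_Ici, Measure.restrict_apply (hZ measurableSet_Ici),
      Set.inter_comm, Measure.smul_apply, smul_eq_mul]
    rcases le_total 0 z with hz | hz
    · rw [expMeasure_Ici hl hz, mul_comm]
      exact key B hB z hz
    · rw [expMeasure_Ici_of_nonpos hl hz, mul_one]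
      refine le_antisymm (measure_mono Set.inter_subset_left) ?_
      have := key B hB 0 le_rfl
      simp only [mul_zero, neg_zero, Real.exp_zero, ENNReal.ofReal_one, one_mul] at this
      rw [← this]
      exact measure_mono (Set.inter_subset_inter_right _ fun ω hω => le_trans hz hω)
  have : IsProbabilityMeasure
      (P.map (fun ω => (S ω, firstPassage (S ω) (fun i => G i ω) - S ω))) :=
    Measure.isProbabilityMeasure_map (hS.prodMk hZ).aemeasurable
  refine Measure.ext_prod fun {s t} hs ht => ?_
  rw [Measure.map_apply (hS.prodMk hZ) (hs.prod ht), Measure.prod_prod, Measure.map_apply hS hs]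
  have := congrArg (fun ν => ν t) (hB s hs)
  simp only [Measure.map_apply hZ ht, Measure.restrict_apply (hZ ht), Measure.smul_apply,
    smul_eq_mul] at this
  rw [← this, Set.inter_comm]
  rfl

/-! ### A law of large numbers for orthogonal sequences -/

/-- By Tonelli the sum of the squares has finite mean, so it is almost surely finite and its terms
vanish. -/
lemma ae_tendsto_zero_of_summable_sq {Ω : Type*} [MeasurableSpace Ω] {P : Measure Ω}
    {X : ℕ → Ω → ℝ} (hX : ∀ n, MemLp (X n) 2 P) (hs : Summable fun n => ∫ ω, X n ω ^ 2 ∂P) :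
    ∀ᵐ ω ∂P, Tendsto (fun n => X n ω) atTop (𝓝 0) := by
  have hm : ∀ n, AEMeasurable (fun ω => ENNReal.ofReal (X n ω ^ 2)) P := fun n =>
    ((hX n).aestronglyMeasurable.aemeasurable.pow_const 2).ennreal_ofReal
  have hfin : ∫⁻ ω, ∑' n, ENNReal.ofReal (X n ω ^ 2) ∂P ≠ ⊤ := by
    rw [lintegral_tsum hm]
    have : ∀ n, ∫⁻ ω, ENNReal.ofReal (X n ω ^ 2) ∂P = ENNReal.ofReal (∫ ω, X n ω ^ 2 ∂P) :=
      fun n => (ofReal_integral_eq_lintegral_ofReal (hX n).integrable_sq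
        (Eventually.of_forall fun ω => sq_nonneg _)).symm
    simp_rw [this]
    exact hs.tsum_ofReal_ne_top
  filter_upwards [ae_lt_top' (AEMeasurable.tsum hm) hfin] with ω hω
  have h1 := ENNReal.tendsto_atTop_zero_of_tsum_ne_top hω.ne
  have h2 : Tendsto (fun n => X n ω ^ 2) atTop (𝓝 0) := by
    have := (ENNReal.tendsto_toReal ENNReal.zero_ne_top).comp h1
    simpa [Function.comp_def, ENNReal.toReal_ofReal (sq_nonneg _)] using this
  have h3 := h2.sqrt
  simp only [Real.sqrt_sq_eq_abs, Real.sqrt_zero] at h3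
  exact (tendsto_zero_iff_abs_tendsto_zero _).2 h3

lemma integral_sq_sum_of_orthogonal {Ω : Type*} [MeasurableSpace Ω] {P : Measure Ω}
    {D : ℕ → Ω → ℝ} (hD : ∀ i, MemLp (D i) 2 P)
    (horth : ∀ i j, i < j → ∫ ω, D i ω * D j ω ∂P = 0) (n : ℕ) :
    ∫ ω, (∑ i ∈ Finset.range n, D i ω) ^ 2 ∂P = ∑ i ∈ Finset.range n, ∫ ω, D i ω ^ 2 ∂P := by
  have hint : ∀ i j, Integrable (fun ω => D i ω * D j ω) P := fun i j => (hD i).integrable_mul (hD j)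
  induction n with
  | zero => simp
  | succ n ih =>
    have hS : MemLp (fun ω => ∑ i ∈ Finset.range n, D i ω) 2 P := memLp_finsetSum _ fun i _ => hD i
    have h1 : ∀ ω, (∑ i ∈ Finset.range (n + 1), D i ω) ^ 2 =
        (∑ i ∈ Finset.range n, D i ω) ^ 2 + (2 * ∑ i ∈ Finset.range n, D i ω * D n ω + D n ω ^ 2) := by
      intro ω; rw [Finset.sum_range_succ, ← Finset.sum_mul]; ring
    simp_rw [h1]
    have hc : Integrable (fun ω => ∑ i ∈ Finset.range n, D i ω * D n ω) P :=
      integrable_finsetSum _ fun i _ => hint i n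
    have h2 : Integrable (fun ω => 2 * ∑ i ∈ Finset.range n, D i ω * D n ω + D n ω ^ 2) P :=
      (hc.const_mul 2).add (hD n).integrable_sq
    rw [integral_add hS.integrable_sq h2, integral_add (hc.const_mul 2) (hD n).integrable_sq, integral_const_mul,
      integral_finsetSum _ fun i _ => hint i n,
      Finset.sum_eq_zero fun i hi => horth i n (Finset.mem_range.1 hi), ih, Finset.sum_range_succ]
    ring

lemma integral_sq_sum_abs_le {Ω : Type*} [MeasurableSpace Ω] {P : Measure Ω}
    {D : ℕ → Ω → ℝ} {c : ℝ} (hD : ∀ i, MemLp (D i) 2 P)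
    (hc : ∀ i, ∫ ω, D i ω ^ 2 ∂P ≤ c) (s : Finset ℕ) :
    ∫ ω, (∑ i ∈ s, |D i ω|) ^ 2 ∂P ≤ (s.card : ℝ) ^ 2 * c := by
  have hS : MemLp (fun ω => ∑ i ∈ s, |D i ω|) 2 P := memLp_finsetSum _ fun i _ => (hD i).abs
  calc ∫ ω, (∑ i ∈ s, |D i ω|) ^ 2 ∂P
      ≤ ∫ ω, (s.card : ℝ) * ∑ i ∈ s, D i ω ^ 2 ∂P := by
        refine integral_mono hS.integrable_sq
          ((integrable_finsetSum _ fun i _ => (hD i).integrable_sq).const_mul _) fun ω => ?_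
        simpa only [sq_abs] using sq_sum_le_card_mul_sum_sq (s := s) (f := fun i => |D i ω|)
    _ = (s.card : ℝ) * ∑ i ∈ s, ∫ ω, D i ω ^ 2 ∂P := by
        rw [integral_const_mul, integral_finsetSum _ fun i _ => (hD i).integrable_sq]
    _ ≤ (s.card : ℝ) * (s.card * c) := by
        gcongr
        simpa using Finset.sum_le_card_nsmul s _ c fun i _ => hc i
    _ = _ := by ring

lemma summable_const_div_succ_sq (c : ℝ) : Summable fun n : ℕ => c / ((n : ℝ) + 1) ^ 2 := by
  have h : Summable fun n : ℕ => 1 / (((n + 1 : ℕ) : ℝ)) ^ 2 :=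
    (summable_nat_add_iff 1).2 (Real.summable_one_div_nat_pow.2 one_lt_two)
  refine (h.mul_left c).congr fun n => ?_
  push_cast; ring

/-- Along the squares `(n + 1)²` the averages have second moment at most `c / (n + 1)²` by
Pythagoras, which is summable. Between consecutive squares the partial sum moves by at most the sum
of `|D i|` over a block of `2n + 3` terms. By Cauchy–Schwarz this is also summable in mean square
after normalisation. Neither independence nor a common law is needed. -/
theorem ae_tendsto_average_of_orthogonal {Ω : Type*} [MeasurableSpace Ω] {P : Measure Ω}
    {D : ℕ → Ω → ℝ} {c : ℝ} (hD : ∀ i, MemLp (D i) 2 P)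
    (horth : ∀ i j, i < j → ∫ ω, D i ω * D j ω ∂P = 0)
    (hc : ∀ i, ∫ ω, D i ω ^ 2 ∂P ≤ c) :
    ∀ᵐ ω ∂P, Tendsto (fun n : ℕ => (∑ i ∈ Finset.range n, D i ω) / n) atTop (𝓝 0) := by
  have hc0 : 0 ≤ c := le_trans (integral_nonneg fun ω => sq_nonneg _) (hc 0)
  let I : ℕ → Finset ℕ := fun n => Finset.Ico ((n + 1) ^ 2) ((n + 2) ^ 2)
  let a : ℕ → Ω → ℝ := fun n ω => (((n : ℝ) + 1) ^ 2)⁻¹ * ∑ i ∈ Finset.range ((n + 1) ^ 2), D i ω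
  let b : ℕ → Ω → ℝ := fun n ω => (((n : ℝ) + 1) ^ 2)⁻¹ * ∑ i ∈ I n, |D i ω|
  have ha : ∀ᵐ ω ∂P, Tendsto (fun n => a n ω) atTop (𝓝 0) := by
    refine ae_tendsto_zero_of_summable_sq
      (fun n => (memLp_finsetSum _ fun i _ => hD i).const_mul _) ?_
    refine Summable.of_nonneg_of_le (fun n => integral_nonneg fun ω => sq_nonneg _) (fun n => ?_)
      (summable_const_div_succ_sq c)
    simp only [a, mul_pow]
    rw [integral_const_mul, integral_sq_sum_of_orthogonal hD horth]
    have h1 : ∑ i ∈ Finset.range ((n + 1) ^ 2), ∫ ω, D i ω ^ 2 ∂P ≤ ((n : ℝ) + 1) ^ 2 * c := by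
      refine le_trans (Finset.sum_le_card_nsmul (Finset.range ((n + 1) ^ 2)) _ c fun i _ => hc i) (by simp)
    calc _ ≤ ((((n : ℝ) + 1) ^ 2)⁻¹) ^ 2 * (((n : ℝ) + 1) ^ 2 * c) := by gcongr
      _ = _ := by field_simp
  have hb : ∀ᵐ ω ∂P, Tendsto (fun n => b n ω) atTop (𝓝 0) := by
    refine ae_tendsto_zero_of_summable_sq
      (fun n => (memLp_finsetSum _ fun i _ => (hD i).abs).const_mul _) ?_
    refine Summable.of_nonneg_of_le (fun n => integral_nonneg fun ω => sq_nonneg _) (fun n => ?_)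
      -- The constant is `3²`, from the block length `2n + 3 ≤ 3 (n + 1)`.
      (summable_const_div_succ_sq (9 * c))
    simp only [b, mul_pow]
    rw [integral_const_mul]
    have hcard : ((I n).card : ℝ) ≤ 3 * ((n : ℝ) + 1) := by
      have : (I n).card = 2 * n + 3 := by
        simp only [I, Nat.card_Ico]; rw [Nat.sub_eq_iff_eq_add (by gcongr; omega)]; ring
      rw [this]; push_cast; have : (0 : ℝ) ≤ n := n.cast_nonneg
      linarith
    calc _ ≤ ((((n : ℝ) + 1) ^ 2)⁻¹) ^ 2 * ((3 * ((n : ℝ) + 1)) ^ 2 * c) := by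
          gcongr
          refine (integral_sq_sum_abs_le hD hc (I n)).trans ?_
          gcongr
      _ = _ := by field_simp; ring
  filter_upwards [ha, hb] with ω hωa hωb
  have hsq : Tendsto (fun m : ℕ => Nat.sqrt (m + 1) - 1) atTop atTop := by
    refine tendsto_atTop.2 fun N => eventually_atTop.2 ⟨(N + 1) ^ 2, fun m hm => ?_⟩
    have : N + 1 ≤ Nat.sqrt (m + 1) := Nat.le_sqrt'.2 (by omega)
    omega
  -- Passing to `m + 1` makes the integer square root at least `1`, so it can be written `n + 1`.
  rw [← tendsto_add_atTop_iff_nat 1]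
  have hlim := ((hωa.abs).comp hsq).add (hωb.comp hsq)
  simp only [abs_zero, add_zero] at hlim
  refine squeeze_zero_norm (fun m => ?_) hlim
  have hpos : 1 ≤ Nat.sqrt (m + 1) := Nat.le_sqrt'.2 (by omega)
  obtain ⟨n, hn⟩ : ∃ n, Nat.sqrt (m + 1) = n + 1 := ⟨Nat.sqrt (m + 1) - 1, by omega⟩
  have h1 : (n + 1) ^ 2 ≤ m + 1 := hn ▸ Nat.sqrt_le' (m + 1)
  have h2 : m + 1 < (n + 2) ^ 2 := by have := Nat.lt_succ_sqrt' (m + 1); rwa [hn] at this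
  simp only [Function.comp_apply, hn, Nat.add_sub_cancel, Real.norm_eq_abs]
  have hsplit : ∑ i ∈ Finset.range (m + 1), D i ω =
      ∑ i ∈ Finset.range ((n + 1) ^ 2), D i ω + ∑ i ∈ Finset.Ico ((n + 1) ^ 2) (m + 1), D i ω :=
    (Finset.sum_range_add_sum_Ico _ h1).symm
  have hle : |∑ i ∈ Finset.range (m + 1), D i ω| ≤
      |∑ i ∈ Finset.range ((n + 1) ^ 2), D i ω| + ∑ i ∈ I n, |D i ω| := by
    rw [hsplit]
    refine (abs_add_le _ _).trans (by
      gcongr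
      refine (Finset.abs_sum_le_sum_abs _ _).trans ?_
      exact Finset.sum_le_sum_of_subset_of_nonneg (Finset.Ico_subset_Ico le_rfl h2.le)
        fun _ _ _ => abs_nonneg _)
  have hm : (((n : ℝ) + 1) ^ 2) ≤ ((m + 1 : ℕ) : ℝ) := by exact_mod_cast h1
  have hn0 : (0 : ℝ) < ((n : ℝ) + 1) ^ 2 := by positivity
  rw [abs_div, abs_of_nonneg (Nat.cast_nonneg (m + 1) : (0 : ℝ) ≤ _)]
  simp only [a, b, abs_mul, abs_of_pos (inv_pos.2 hn0)]
  rw [← mul_add, inv_mul_eq_div]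
  exact div_le_div₀ (by positivity) hle hn0 hm

/-! ### Sample paths of the age -/

namespace SamplingSystem

variable {Ω : Type*} (M : SamplingSystem Ω)

/-- On the sample path `ω` all service times are positive and every update cycle is at least as
long as the service time in it. -/
def IsRegularPath (ω : Ω) : Prop :=
  ∀ j, 0 < M.service j ω ∧ M.service j ω ≤ M.cycle j ω

variable {M} {ω : Ω}

lemma genTime_zero : M.genTime 0 ω = 0 := by simp [genTime]

lemma genTime_succ (j : ℕ) : M.genTime (j + 1) ω = M.genTime j ω + M.cycle j ω := by
  simp [genTime, Finset.sum_range_succ]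

namespace IsRegularPath

variable (h : M.IsRegularPath ω)
include h

lemma cycle_pos (j : ℕ) : 0 < M.cycle j ω := (h j).1.trans_le (h j).2

lemma strictMono_genTime : StrictMono fun j => M.genTime j ω :=
  strictMono_nat_of_lt_succ fun j => by
    have := h.cycle_pos j
    rw [genTime_succ]; linarith

lemma genTime_nonneg (j : ℕ) : 0 ≤ M.genTime j ω := by
  have := h.strictMono_genTime.monotone (Nat.zero_le j)
  simpa [genTime_zero] using this

lemma strictMono_delivery : StrictMono fun j => M.delivery j ω :=
  strictMono_nat_of_lt_succ fun j => by
    have h1 := (h j).2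
    have h2 := (h (j + 1)).1
    simp only [delivery, genTime_succ]; linarith

lemma genTime_lt_delivery (j : ℕ) : M.genTime j ω < M.delivery j ω := by
  have h1 := (h j).1
  simp only [delivery]; linarith

lemma bddAbove_timestamps (a₀ t : ℝ) :
    BddAbove (insert (-a₀) {u | ∃ j, M.delivery j ω ≤ t ∧ u = M.genTime j ω}) := by
  refine BddAbove.insert _ ⟨t, ?_⟩
  rintro u ⟨j, hj, rfl⟩
  exact (h.genTime_lt_delivery j).le.trans hj

/-- On a regular path the set of time-stamps is bounded above, so `sSup` is a genuine supremum. The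
values and bounds of the time-stamp below are derived from this characterisation. -/
lemma timestamp_le_iff {a₀ t v : ℝ} :
    M.timestamp a₀ t ω ≤ v ↔ -a₀ ≤ v ∧ ∀ j, M.delivery j ω ≤ t → M.genTime j ω ≤ v := by
  rw [timestamp, csSup_le_iff (h.bddAbove_timestamps a₀ t) (Set.insert_nonempty _ _)]
  constructor
  · exact fun H => ⟨H _ (Set.mem_insert _ _), fun j hj => H _ (Set.mem_insert_of_mem _ ⟨j, hj, rfl⟩)⟩
  · rintro ⟨h1, h2⟩ u (rfl | ⟨j, hj, rfl⟩)
    exacts [h1, h2 j hj]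

lemma neg_le_timestamp (a₀ t : ℝ) : -a₀ ≤ M.timestamp a₀ t ω :=
  (h.timestamp_le_iff.1 le_rfl).1

lemma genTime_le_timestamp {a₀ t : ℝ} {j : ℕ} (hj : M.delivery j ω ≤ t) :
    M.genTime j ω ≤ M.timestamp a₀ t ω :=
  (h.timestamp_le_iff.1 le_rfl).2 j hj

lemma monotone_timestamp (a₀ : ℝ) : Monotone fun t => M.timestamp a₀ t ω := fun _ _ hst =>
  h.timestamp_le_iff.2 ⟨h.neg_le_timestamp _ _, fun _ hj => h.genTime_le_timestamp (hj.trans hst)⟩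

lemma timestamp_of_lt {a₀ t : ℝ} (ht : t < M.delivery 0 ω) : M.timestamp a₀ t ω = -a₀ := by
  refine le_antisymm (h.timestamp_le_iff.2 ⟨le_rfl, fun j hj => ?_⟩) (h.neg_le_timestamp _ _)
  have h1 : M.delivery 0 ω ≤ M.delivery j ω := h.strictMono_delivery.monotone (Nat.zero_le j)
  linarith

lemma timestamp_of_mem {a₀ t : ℝ} (ha : 0 ≤ a₀) {j : ℕ} (h1 : M.delivery j ω ≤ t)
    (h2 : t < M.delivery (j + 1) ω) : M.timestamp a₀ t ω = M.genTime j ω := by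
  refine le_antisymm (h.timestamp_le_iff.2 ⟨?_, fun i hi => ?_⟩) (h.genTime_le_timestamp h1)
  · have := h.genTime_nonneg j
    linarith
  · have : i < j + 1 := h.strictMono_delivery.lt_iff_lt.1 (hi.trans_lt h2)
    exact h.strictMono_genTime.monotone (by omega)

lemma age_nonneg {a₀ t : ℝ} (ha : 0 ≤ a₀) (ht : 0 ≤ t) : 0 ≤ M.age a₀ t ω :=
  sub_nonneg.2 (h.timestamp_le_iff.2 ⟨by linarith, fun j hj =>
    (h.genTime_lt_delivery j).le.trans hj⟩)

lemma intervalIntegrable_age (a₀ x y : ℝ) :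
    IntervalIntegrable (fun t => M.age a₀ t ω) volume x y :=
  intervalIntegral.intervalIntegrable_id.sub (h.monotone_timestamp a₀).intervalIntegrable

/-- The packets generated after `v` are those numbered from `j + 1` on, and deliveries occur in
order, so only the delivery of packet `j + 1` matters. -/
lemma timestamp_le_iff_lt_delivery {a₀ t v : ℝ} (ha : 0 ≤ a₀) {j : ℕ} (h1 : M.genTime j ω ≤ v)
    (h2 : v < M.genTime (j + 1) ω) : M.timestamp a₀ t ω ≤ v ↔ t < M.delivery (j + 1) ω := by
  rw [h.timestamp_le_iff]
  have h0 := h.genTime_nonneg j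
  constructor
  · rintro ⟨-, H⟩
    by_contra! ht
    exact absurd (H _ ht) (not_le.2 h2)
  · refine fun ht => ⟨by linarith, fun i hi => ?_⟩
    have : i < j + 1 := h.strictMono_delivery.lt_iff_lt.1 (hi.trans_lt ht)
    have h3 : M.genTime i ω ≤ M.genTime j ω := h.strictMono_genTime.monotone (Nat.lt_succ_iff.1 this)
    linarith

/-- In the coordinates `v = t - a` and `a`, the condition `a ≤ Δ(t)` says that the time-stamp is at
most `v`, that is, packet `j + 1` is not yet delivered at time `v + a`. The region becomes `0 ≤ a <
E - v` over `T ≤ v < T'`, a trapezoid, and the shear preserves area. -/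
theorem area_eq {a₀ : ℝ} (ha : 0 ≤ a₀) (j : ℕ) :
    M.area a₀ j ω = M.cycle j ω ^ 2 / 2 + M.cycle j ω * M.service (j + 1) ω := by
  set T := M.genTime j ω with hT
  set T' := M.genTime (j + 1) ω with hT'
  set E := M.delivery (j + 1) ω with hE
  have hTT : T ≤ T' := h.strictMono_genTime.monotone (Nat.le_succ j)
  have hTE : T' < E := h.genTime_lt_delivery (j + 1)
  have hset : {x : ℝ × ℝ | 0 ≤ x.2 ∧ x.2 ≤ M.age a₀ x.1 ω ∧ T ≤ x.1 - x.2 ∧ x.1 - x.2 < T'} =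
      (fun z : ℝ × ℝ => (z.1 - z.2, z.2)) ⁻¹'
        {z | z.1 ∈ Set.Ico T T' ∧ 0 ≤ z.2 ∧ z.2 < E - z.1} := by
    ext ⟨t, a⟩
    simp only [Set.mem_ofPred_eq, Set.mem_preimage, Set.mem_Ico]
    constructor
    · rintro ⟨h1, h2, h3, h4⟩
      have := (h.timestamp_le_iff_lt_delivery ha h3 h4).1
        (show M.timestamp a₀ t ω ≤ t - a by unfold age at h2; linarith)
      exact ⟨⟨h3, h4⟩, h1, by linarith⟩
    · rintro ⟨⟨h3, h4⟩, h1, h2⟩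
      have := (h.timestamp_le_iff_lt_delivery (t := t) ha h3 h4).2 (by linarith)
      exact ⟨h1, by unfold age; linarith, h3, h4⟩
  have hmeas : MeasurableSet {z : ℝ × ℝ | z.1 ∈ Set.Ico T T' ∧ 0 ≤ z.2 ∧ z.2 < E - z.1} :=
    (measurable_fst measurableSet_Ico).inter
      ((measurableSet_le measurable_const measurable_snd).inter
        (measurableSet_lt measurable_snd (measurable_const.sub measurable_fst)))
  have hvol : (volume : Measure (ℝ × ℝ))
      {z : ℝ × ℝ | z.1 ∈ Set.Ico T T' ∧ 0 ≤ z.2 ∧ z.2 < E - z.1} =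
        ENNReal.ofReal (∫ v in T..T', (E - v)) := by
    rw [Measure.volume_eq_prod, Measure.prod_apply hmeas, intervalIntegral.integral_of_le hTT,
      ← integral_Ico_eq_integral_Ioc, ofReal_integral_eq_lintegral_ofReal,
      ← lintegral_indicator measurableSet_Ico]
    · refine lintegral_congr fun v => ?_
      by_cases hv : v ∈ Set.Ico T T'
      · rw [Set.indicator_of_mem hv]
        have : Prod.mk v ⁻¹' {z : ℝ × ℝ | z.1 ∈ Set.Ico T T' ∧ 0 ≤ z.2 ∧ z.2 < E - z.1} =
            Set.Ico 0 (E - v) := by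
          ext a
          simp only [Set.mem_preimage, Set.mem_ofPred_eq, Set.mem_Ico]
          exact ⟨fun H => H.2, fun H => ⟨hv, H⟩⟩
        rw [this, Real.volume_Ico, sub_zero]
      · rw [Set.indicator_of_notMem hv]
        have : Prod.mk v ⁻¹' {z : ℝ × ℝ | z.1 ∈ Set.Ico T T' ∧ 0 ≤ z.2 ∧ z.2 < E - z.1} = ∅ :=
          Set.eq_empty_of_forall_notMem fun a H => hv H.1
        rw [this, measure_empty]
    · exact (continuous_const.sub continuous_id).integrableOn_Icc.mono_set Set.Ico_subset_Icc_self
    · filter_upwards [ae_restrict_mem measurableSet_Ico] with v hv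
      have := hv.2
      simp only [Pi.zero_apply]
      linarith
  have hint : ∫ v in T..T', (E - v) = M.cycle j ω ^ 2 / 2 + M.cycle j ω * M.service (j + 1) ω := by
    rw [intervalIntegral.integral_sub (by simp) (by simp), integral_id,
      intervalIntegral.integral_const, hE, delivery, ← hT', hT', genTime_succ, ← hT, smul_eq_mul]
    ring
  have h1 := h.cycle_pos j
  have h2 := (h (j + 1)).1
  rw [area, hset, measureReal_def, Measure.volume_eq_prod,
    (measurePreserving_sub_prod (volume : Measure ℝ) (volume : Measure ℝ)).measure_preimage
      hmeas.nullMeasurableSet, ← Measure.volume_eq_prod, hvol, hint,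
    ENNReal.toReal_ofReal (by positivity)]

/-- Cut along lines of slope one, the region under the curve up to delivery `n` consists of the
first `n` areas, a final triangle with legs `S_n`, and the parallelogram of area `a₀ S_0` lying
before the line from the origin. -/
theorem integral_age_delivery {a₀ : ℝ} (ha : 0 ≤ a₀) (n : ℕ) :
    ∫ t in (0 : ℝ)..M.delivery n ω, M.age a₀ t ω =
      ∑ j ∈ Finset.range n, M.area a₀ j ω + M.service n ω ^ 2 / 2 + a₀ * M.service 0 ω := by
  have aux : ∀ x y u : ℝ, x ≤ y → (∀ t, x ≤ t → t < y → M.timestamp a₀ t ω = u) →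
      ∫ t in x..y, M.age a₀ t ω = ((y - u) ^ 2 - (x - u) ^ 2) / 2 := by
    intro x y u hxy hu
    have h1 : ∫ t in x..y, M.age a₀ t ω = ∫ t in x..y, (t - u) := by
      refine intervalIntegral.integral_congr_ae ?_
      filter_upwards [Measure.ae_ne volume y] with t hty ht
      rw [Set.uIoc_of_le hxy] at ht
      rw [age, hu t ht.1.le (lt_of_le_of_ne ht.2 hty)]
    rw [h1, intervalIntegral.integral_sub (by simp) (by simp), integral_id,
      intervalIntegral.integral_const, smul_eq_mul]
    ring
  induction n with
  | zero =>
    have hD : M.delivery 0 ω = M.service 0 ω := by simp [delivery, genTime_zero]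
    rw [aux 0 _ (-a₀) (by rw [hD]; exact (h 0).1.le) fun t _ ht => h.timestamp_of_lt ht, hD]
    simp; ring
  | succ n ih =>
    rw [← intervalIntegral.integral_add_adjacent_intervals (h.intervalIntegrable_age a₀ _ _)
      (h.intervalIntegrable_age a₀ (M.delivery n ω) _), ih,
      aux _ _ (M.genTime n ω) (h.strictMono_delivery.monotone (Nat.le_succ n))
        fun t h1 h2 => h.timestamp_of_mem ha h1 h2, Finset.sum_range_succ, h.area_eq ha n]
    simp only [delivery, genTime_succ]
    ring

/-- For `τ` between deliveries `n` and `n + 1`, `F τ / τ` lies between `F (D n) / D (n + 1)` and `F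
(D (n + 1)) / D n`. An index shift does not change limits of quotients by `n`, so both bounds have
the same limit. -/
theorem tendsto_timeAverage {a₀ mY mQ : ℝ} (ha : 0 ≤ a₀) (hmY : 0 < mY)
    (hY : Tendsto (fun n : ℕ => (∑ j ∈ Finset.range n, M.cycle j ω) / n) atTop (𝓝 mY))
    (hQ : Tendsto (fun n : ℕ => (∑ j ∈ Finset.range n, M.area a₀ j ω) / n) atTop (𝓝 mQ))
    (hS : Tendsto (fun n : ℕ => M.service n ω / n) atTop (𝓝 0))
    (hS2 : Tendsto (fun n : ℕ => M.service n ω ^ 2 / n) atTop (𝓝 0)) :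
    Tendsto (fun τ : ℝ => (1 / τ) * ∫ t in (0 : ℝ)..τ, M.age a₀ t ω) atTop (𝓝 (mQ / mY)) := by
  set D : ℕ → ℝ := fun n => M.delivery n ω
  set F : ℝ → ℝ := fun τ => ∫ t in (0 : ℝ)..τ, M.age a₀ t ω
  have hD : Tendsto (fun n : ℕ => D n / n) atTop (𝓝 mY) := by
    have := hY.add hS
    rw [add_zero] at this
    refine this.congr fun n => ?_
    simp only [D, delivery, genTime, add_div]
  have hF : Tendsto (fun n : ℕ => F (D n) / n) atTop (𝓝 mQ) := by
    have := (hQ.add (hS2.div_const 2)).add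
      (tendsto_const_div_atTop_nhds_zero_nat (a₀ * M.service 0 ω))
    rw [zero_div, add_zero, add_zero] at this
    refine this.congr fun n => ?_
    simp only [F, D, h.integral_age_delivery ha n]
    ring
  have hD0 : ∀ n, 0 < D n := fun n => (h.genTime_nonneg n).trans_lt (h.genTime_lt_delivery n)
  have hDmono : StrictMono D := h.strictMono_delivery
  have hDtop : Tendsto D atTop atTop := by
    have := Tendsto.pos_mul_atTop hmY hD tendsto_natCast_atTop_atTop
    refine this.congr' ?_
    filter_upwards [eventually_gt_atTop 0] with n hn
    have : (n : ℝ) ≠ 0 := by positivity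
    field_simp
  have hFmono : ∀ x y, 0 ≤ x → x ≤ y → F x ≤ F y := by
    intro x y hx hxy
    have h1 : F x + ∫ t in x..y, M.age a₀ t ω = F y :=
      intervalIntegral.integral_add_adjacent_intervals (h.intervalIntegrable_age a₀ _ _)
        (h.intervalIntegrable_age a₀ _ _)
    have h2 : 0 ≤ ∫ t in x..y, M.age a₀ t ω :=
      intervalIntegral.integral_nonneg hxy fun t ht => h.age_nonneg ha (hx.trans ht.1)
    linarith
  have hF0 : ∀ x, 0 ≤ x → 0 ≤ F x := fun x hx => by simpa [F] using hFmono 0 x le_rfl hx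
  have hsucc : Tendsto (fun n : ℕ => ((n + 1 : ℕ) : ℝ) / n) atTop (𝓝 1) := by
    have := (tendsto_const_nhds (x := (1 : ℝ))).add (tendsto_const_div_atTop_nhds_zero_nat (1 : ℝ))
    rw [add_zero] at this
    refine this.congr' ?_
    filter_upwards [eventually_gt_atTop 0] with n hn
    have : (n : ℝ) ≠ 0 := by positivity
    push_cast; field_simp
  have hD1 : Tendsto (fun n : ℕ => D (n + 1) / n) atTop (𝓝 mY) := by
    have := (hD.comp (tendsto_add_atTop_nat 1)).mul hsucc
    rw [mul_one] at this
    refine this.congr fun n => ?_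
    have : ((n + 1 : ℕ) : ℝ) ≠ 0 := by positivity
    simp only [Function.comp_apply]
    field_simp
  have hF1 : Tendsto (fun n : ℕ => F (D (n + 1)) / n) atTop (𝓝 mQ) := by
    have := (hF.comp (tendsto_add_atTop_nat 1)).mul hsucc
    rw [mul_one] at this
    refine this.congr fun n => ?_
    have : ((n + 1 : ℕ) : ℝ) ≠ 0 := by positivity
    simp only [Function.comp_apply]
    field_simp
  have hcancel : ∀ a b : ℕ → ℝ, (fun n : ℕ => (a n / n) / (b n / n)) =ᶠ[atTop] fun n => a n / b n := by
    intro a b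
    filter_upwards [eventually_gt_atTop 0] with n hn
    have : (n : ℝ) ≠ 0 := by positivity
    rw [div_div_div_cancel_right₀ this]
  have hlow : Tendsto (fun n => F (D n) / D (n + 1)) atTop (𝓝 (mQ / mY)) :=
    (hF.div hD1 hmY.ne').congr' (hcancel _ _)
  have hup : Tendsto (fun n => F (D (n + 1)) / D n) atTop (𝓝 (mQ / mY)) :=
    (hF1.div hD hmY.ne').congr' (hcancel _ _)
  have hex : ∀ τ, ∃ n, τ < D (n + 1) := fun τ =>
    ((hDtop.comp (tendsto_add_atTop_nat 1)).eventually_gt_atTop τ).exists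
  classical
  let N : ℝ → ℕ := fun τ => Nat.find (hex τ)
  have hN2 : ∀ τ, τ < D (N τ + 1) := fun τ => Nat.find_spec (hex τ)
  -- The restriction to `D 0 ≤ τ` is needed because `N τ = 0` also before the first delivery.
  have hN1 : ∀ τ, D 0 ≤ τ → D (N τ) ≤ τ := by
    intro τ hτ
    rcases Nat.eq_zero_or_pos (N τ) with h0 | h0
    · rw [h0]; exact hτ
    · have := Nat.find_min (hex τ) (m := N τ - 1) (by change N τ - 1 < N τ; omega)
      rw [Nat.sub_add_cancel h0] at this
      exact not_lt.1 this
  have hNtop : Tendsto N atTop atTop := by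
    refine tendsto_atTop.2 fun n => ?_
    filter_upwards [eventually_ge_atTop (D n)] with τ hτ
    have := hDmono.lt_iff_lt.1 (hτ.trans_lt (hN2 τ))
    omega
  refine tendsto_of_tendsto_of_tendsto_of_le_of_le' (hlow.comp hNtop) (hup.comp hNtop) ?_ ?_
  · filter_upwards [eventually_ge_atTop (D 0)] with τ hτ
    have h0 : 0 < τ := (hD0 0).trans_le hτ
    simp only [Function.comp_apply, one_div, inv_mul_eq_div]
    exact div_le_div₀ (hF0 _ h0.le) (hFmono _ _ (hD0 _).le (hN1 τ hτ)) h0 (hN2 τ).le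
  · filter_upwards [eventually_ge_atTop (D 0)] with τ hτ
    have h0 : 0 < τ := (hD0 0).trans_le hτ
    simp only [Function.comp_apply, one_div, inv_mul_eq_div]
    exact div_le_div₀ (hF0 _ (hD0 _).le) (hFmono _ _ h0.le (hN2 τ).le) (hD0 _) (hN1 τ hτ)

end IsRegularPath

lemma tendsto_average_div_average {a₀ mY mQ : ℝ} (hmY : 0 < mY)
    (hY : Tendsto (fun n : ℕ => (∑ j ∈ Finset.range n, M.cycle j ω) / n) atTop (𝓝 mY))
    (hQ : Tendsto (fun n : ℕ => (∑ j ∈ Finset.range n, M.area a₀ j ω) / n) atTop (𝓝 mQ)) :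
    Tendsto (fun n : ℕ => ((1 / (n : ℝ)) * ∑ j ∈ Finset.range n, M.area a₀ j ω) /
      ((1 / (n : ℝ)) * ∑ j ∈ Finset.range n, M.cycle j ω)) atTop (𝓝 (mQ / mY)) := by
  simp only [one_div, inv_mul_eq_div]
  exact hQ.div hY hmY.ne'

end SamplingSystem

lemma memLp_expMeasure {r : ℝ} (hr : 0 < r) {n : ℕ} (hn : n ≠ 0) :
    MemLp (fun x : ℝ => x) n (expMeasure r) := by
  rw [← integrable_norm_rpow_iff measurable_id'.aestronglyMeasurable (by exact_mod_cast hn)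
    (ENNReal.natCast_ne_top n)]
  refine (integrable_pow_expMeasure hr n).norm.congr (Eventually.of_forall fun x => ?_)
  simp

namespace SamplingSystem

variable {Ω : Type*}

/-! ### The cycles computed with a prescribed state -/

section Basic

variable (M : SamplingSystem Ω)

/-- The length that update cycle `j` has if the sampler is in state `s` during the cycle. -/
noncomputable def cycleIn (s : Fin 2) (j : ℕ) (ω : Ω) : ℝ :=
  firstPassage (M.service j ω) (fun i => M.gap s j i ω)

/-- The area that belongs to update cycle `j` if the sampler is in state `s` during the cycle. -/
noncomputable def areaIn (s : Fin 2) (j : ℕ) (ω : Ω) : ℝ :=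
  M.cycleIn s j ω ^ 2 / 2 + M.cycleIn s j ω * M.service (j + 1) ω

/-- The indicator of the event that the state in update cycle `j` is `s`. -/
noncomputable def stateInd (s : Fin 2) (j : ℕ) (ω : Ω) : ℝ :=
  if M.state j ω = s then 1 else 0

/-- The σ-algebra generated by the service and interarrival times with index in `T`. -/
abbrev timesAlgebra (T : Set (ℕ ⊕ (Fin 2 × ℕ × ℕ))) : MeasurableSpace Ω :=
  ⨆ i ∈ T, MeasurableSpace.comap (M.times i) inferInstance

/-- The indices of the service and interarrival times that can occur in update cycle `j`. -/
def cycleIndices (j : ℕ) : Set (ℕ ⊕ (Fin 2 × ℕ × ℕ)) :=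
  {i | i = Sum.inl j ∨ ∃ s k, i = Sum.inr (s, j, k)}

variable {M}

/-- This is where the chain is decoupled from the times: the state enters only as the choice between
two functions of the times. -/
lemma cycle_eq_cycleIn (j : ℕ) (ω : Ω) : M.cycle j ω = M.cycleIn (M.state j ω) j ω := rfl

lemma sum_stateInd_mul (f : Fin 2 → ℝ) (j : ℕ) (ω : Ω) :
    ∑ s, M.stateInd s j ω * f s = f (M.state j ω) := by
  simp [stateInd]

lemma stateInd_zero_eq (j : ℕ) (ω : Ω) : M.stateInd 0 j ω = 1 - M.stateInd 1 j ω := by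
  rcases Fin.exists_fin_two.1 ⟨M.state j ω, rfl⟩ with h | h <;> simp [stateInd, h]

lemma abs_stateInd_le (s : Fin 2) (j : ℕ) (ω : Ω) : |M.stateInd s j ω| ≤ 1 := by
  unfold stateInd; split_ifs <;> simp

lemma measurable_times_of_mem {T : Set (ℕ ⊕ (Fin 2 × ℕ × ℕ))} {i} (hi : i ∈ T) :
    Measurable[M.timesAlgebra T] (M.times i) :=
  Measurable.of_comap_le (le_biSup (fun i => MeasurableSpace.comap (M.times i) inferInstance) hi)

lemma measurable_service_of_mem {T : Set (ℕ ⊕ (Fin 2 × ℕ × ℕ))} {j : ℕ} (h : Sum.inl j ∈ T) :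
    Measurable[M.timesAlgebra T] (M.service j) :=
  measurable_times_of_mem h

lemma measurable_gap_of_mem {T : Set (ℕ ⊕ (Fin 2 × ℕ × ℕ))} {s : Fin 2} {j k : ℕ}
    (h : Sum.inr (s, j, k) ∈ T) : Measurable[M.timesAlgebra T] (M.gap s j k) :=
  measurable_times_of_mem h

lemma measurable_cycleIn_of_subset {T : Set (ℕ ⊕ (Fin 2 × ℕ × ℕ))} {j : ℕ}
    (h : cycleIndices j ⊆ T) (s : Fin 2) : Measurable[M.timesAlgebra T] (M.cycleIn s j) :=
  @measurable_firstPassage Ω (M.timesAlgebra T) _ _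
    (measurable_service_of_mem (h (Or.inl rfl)))
    fun k => measurable_gap_of_mem (h (Or.inr ⟨s, k, rfl⟩))

lemma measurable_cycleIn_univ (s : Fin 2) (j : ℕ) :
    Measurable[M.timesAlgebra Set.univ] (M.cycleIn s j) :=
  measurable_cycleIn_of_subset (Set.subset_univ _) s

lemma measurable_areaIn_univ (s : Fin 2) (j : ℕ) :
    Measurable[M.timesAlgebra Set.univ] (M.areaIn s j) :=
  (((measurable_cycleIn_univ s j).pow_const 2).div_const 2).add
    ((measurable_cycleIn_univ s j).mul (measurable_service_of_mem (Set.mem_univ _)))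

lemma disjoint_cycleIndices {i j : ℕ} (h : i ≠ j) : Disjoint (cycleIndices i) (cycleIndices j) := by
  refine Set.disjoint_left.2 ?_
  rintro x (rfl | ⟨s, k, rfl⟩) (h' | ⟨s', k', h'⟩)
  · exact h (by simpa using h')
  · simp at h'
  · simp at h'
  · simp only [Sum.inr.injEq, Prod.mk.injEq] at h'
    exact h h'.2.1

end Basic

/-! ### Independence and laws -/

namespace IsGilbertElliot

variable [MeasurableSpace Ω] {Pr : Measure Ω} {p q μ lb lg : ℝ}
  {M : SamplingSystem Ω} (hM : M.IsGilbertElliot Pr p q μ lb lg)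
include hM

lemma timesAlgebra_le (T : Set (ℕ ⊕ (Fin 2 × ℕ × ℕ))) : M.timesAlgebra T ≤ ‹MeasurableSpace Ω› :=
  iSup₂_le fun i _ => (hM.measurable_times i).comap_le

lemma indep_timesAlgebra {S T : Set (ℕ ⊕ (Fin 2 × ℕ × ℕ))} (h : Disjoint S T) :
    Indep (M.timesAlgebra S) (M.timesAlgebra T) Pr :=
  indep_iSup_of_disjoint (fun i => (hM.measurable_times i).comap_le) hM.indep_times.iIndep h

lemma indepFun_of_disjoint {S T : Set (ℕ ⊕ (Fin 2 × ℕ × ℕ))} (h : Disjoint S T)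
    {X Y : Ω → ℝ} (hX : Measurable[M.timesAlgebra S] X)
    (hY : Measurable[M.timesAlgebra T] Y) : IndepFun X Y Pr := by
  rw [IndepFun_iff_Indep]
  exact indep_of_indep_of_le_left (indep_of_indep_of_le_right (hM.indep_timesAlgebra h)
    hY.comap_le) hX.comap_le

lemma indepFun_states {β : Type*} [MeasurableSpace β] {X : Ω → β}
    (hX : Measurable[M.timesAlgebra Set.univ] X) :
    IndepFun (fun ω j => M.state j ω) X Pr := by
  rw [IndepFun_iff_Indep]
  refine indep_of_indep_of_le_right ((IndepFun_iff_Indep _ _ _).1 hM.indep_chain) ?_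
  refine hX.comap_le.trans (iSup₂_le fun i _ => ?_)
  rw [show M.times i = (fun f => f i) ∘ (fun ω i => M.times i ω) from rfl,
    ← MeasurableSpace.comap_comp]
  exact MeasurableSpace.comap_mono (measurable_pi_apply i).comap_le

lemma measurable_service (j : ℕ) : Measurable (M.service j) := hM.measurable_times (Sum.inl j)

lemma measurable_gap (s : Fin 2) (j k : ℕ) : Measurable (M.gap s j k) :=
  hM.measurable_times (Sum.inr (s, j, k))

lemma measurable_state (j : ℕ) : Measurable (M.state j) := hM.chain.1 j

lemma measurable_cycleIn (s : Fin 2) (j : ℕ) : Measurable (M.cycleIn s j) :=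
  measurable_firstPassage (hM.measurable_service j) (hM.measurable_gap s j)

lemma measurable_stateInd (s : Fin 2) (j : ℕ) : Measurable (M.stateInd s j) :=
  Measurable.ite (hM.measurable_state j (measurableSet_singleton s)) measurable_const
    measurable_const

lemma gap_law (s : Fin 2) (j k : ℕ) : Pr.map (M.gap s j k) = expMeasure (![lb, lg] s) := by
  fin_cases s
  · exact hM.gap_law_bad j k
  · exact hM.gap_law_good j k

lemma ae_service_pos (hμ : 0 < μ) : ∀ᵐ ω ∂Pr, ∀ j, 0 < M.service j ω := by
  rw [ae_all_iff]
  intro j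
  have h := ae_pos_expMeasure hμ
  rw [← hM.service_law j] at h
  exact ae_of_ae_map (hM.measurable_service j).aemeasurable h

/-- By the strong law the arrival times grow linearly with positive slope, hence pass every level.
-/
lemma ae_exists_le_arrival (hl : ∀ s, 0 < ![lb, lg] s) (s : Fin 2) (j : ℕ) :
    ∀ᵐ ω ∂Pr, ∃ k, M.service j ω ≤ ∑ i ∈ Finset.range (k + 1), M.gap s j i ω := by
  have hint : ∫ ω, M.gap s j 0 ω ∂Pr = ∫ x, x ∂expMeasure (![lb, lg] s) := by
    rw [← hM.gap_law s j 0, integral_map (hM.measurable_gap s j 0).aemeasurable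
      measurable_id'.aestronglyMeasurable]
  have hI : Integrable (M.gap s j 0) Pr := by
    have := integrable_id_expMeasure (hl s)
    rw [← hM.gap_law s j 0, integrable_map_measure measurable_id'.aestronglyMeasurable
      (hM.measurable_gap s j 0).aemeasurable] at this
    exact this
  have hlln := strong_law_ae_real (fun k => M.gap s j k) hI
    (fun k k' hk => hM.indep_times.indepFun (i := Sum.inr (s, j, k)) (j := Sum.inr (s, j, k'))
      (by simpa using hk))
    (fun k => ⟨(hM.measurable_gap s j k).aemeasurable, (hM.measurable_gap s j 0).aemeasurable,
      by rw [hM.gap_law, hM.gap_law]⟩)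
  filter_upwards [hlln] with ω hω
  rw [hint] at hω
  have h1 := Tendsto.pos_mul_atTop (integral_expMeasure_pos (hl s)) hω
    tendsto_natCast_atTop_atTop
  obtain ⟨n, hn, hn0⟩ := ((h1.eventually_ge_atTop (M.service j ω)).and (eventually_gt_atTop 0)).exists
  refine ⟨n - 1, ?_⟩
  have h2 : (n : ℝ) ≠ 0 := by positivity
  rw [div_mul_cancel₀ _ h2] at hn
  rwa [Nat.sub_add_cancel hn0]

lemma ae_isRegularPath (hμ : 0 < μ) (hl : ∀ s, 0 < ![lb, lg] s) :
    ∀ᵐ ω ∂Pr, M.IsRegularPath ω := by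
  have h : ∀ᵐ ω ∂Pr, ∀ s j, ∃ k, M.service j ω ≤ ∑ i ∈ Finset.range (k + 1), M.gap s j i ω :=
    ae_all_iff.2 fun s => ae_all_iff.2 fun j => hM.ae_exists_le_arrival hl s j
  filter_upwards [hM.ae_service_pos hμ, h] with ω h1 h2 j
  exact ⟨h1 j, le_firstPassage (h2 _ j)⟩

lemma measurePreserving_service (j : ℕ) : MeasurePreserving (M.service j) Pr (expMeasure μ) :=
  ⟨hM.measurable_service j, hM.service_law j⟩

lemma integral_comp_service (j : ℕ) {f : ℝ → ℝ} (hf : Measurable f) :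
    ∫ ω, f (M.service j ω) ∂Pr = ∫ x, f x ∂expMeasure μ := by
  rw [← hM.service_law j, integral_map (hM.measurable_service j).aemeasurable
    hf.aestronglyMeasurable]

lemma indepFun_cycleIn_service_succ (s : Fin 2) (j : ℕ) :
    IndepFun (M.cycleIn s j) (M.service (j + 1)) Pr :=
  hM.indepFun_of_disjoint (disjoint_cycleIndices (Nat.succ_ne_self j).symm)
    (measurable_cycleIn_of_subset subset_rfl s) (measurable_service_of_mem (Or.inl rfl))

lemma memLp_service (hμ : 0 < μ) (j : ℕ) {n : ℕ} (hn : n ≠ 0) : MemLp (M.service j) n Pr :=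
  (memLp_expMeasure hμ hn).comp_measurePreserving (hM.measurePreserving_service j)

lemma integrable_service (hμ : 0 < μ) (j : ℕ) : Integrable (M.service j) Pr :=
  memLp_one_iff_integrable.1 (by exact_mod_cast hM.memLp_service hμ j one_ne_zero)

variable [IsProbabilityMeasure Pr]

/-- The overshoot theorem is applied with the past at step `k` taken to be all times other than the
`k`-th gap; this contains the true past and is still independent of that gap. -/
theorem map_service_waitingIn (hμ : 0 < μ) (hl : ∀ s, 0 < ![lb, lg] s) (s : Fin 2) (j : ℕ) :
    Pr.map (fun ω => (M.service j ω, M.cycleIn s j ω - M.service j ω)) =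
      (expMeasure μ).prod (expMeasure (![lb, lg] s)) := by
  let T : ℕ → Set (ℕ ⊕ (Fin 2 × ℕ × ℕ)) := fun k => {Sum.inr (s, j, k)}ᶜ
  have := map_overshoot (P := Pr) (hl s) (m := fun k => M.timesAlgebra (T k))
    (fun k => hM.timesAlgebra_le (T k)) (S := M.service j) (G := fun k => M.gap s j k)
    (fun k => hM.measurable_gap s j k) (fun k => hM.gap_law s j k)
    (fun k => measurable_service_of_mem (by simp [T]))
    (fun k i hi => measurable_gap_of_mem (by simp [T]; omega))
    (fun k => indep_of_indep_of_le_right (hM.indep_timesAlgebra disjoint_compl_left)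
      (measurable_gap_of_mem (T := {Sum.inr (s, j, k)}) rfl).comap_le)
    ((hM.ae_service_pos hμ).mono fun ω h => (h j).le) (hM.ae_exists_le_arrival hl s j)
  rw [hM.service_law] at this
  exact this

/-! ### Moments -/

lemma measurePreserving_service_waitingIn (hμ : 0 < μ) (hl : ∀ s, 0 < ![lb, lg] s) (s : Fin 2)
    (j : ℕ) : MeasurePreserving (fun ω => (M.service j ω, M.cycleIn s j ω - M.service j ω)) Pr
      ((expMeasure μ).prod (expMeasure (![lb, lg] s))) :=
  ⟨(hM.measurable_service j).prodMk ((hM.measurable_cycleIn s j).sub (hM.measurable_service j)),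
    hM.map_service_waitingIn hμ hl s j⟩

lemma memLp_cycleIn (hμ : 0 < μ) (hl : ∀ s, 0 < ![lb, lg] s) (s : Fin 2) (j : ℕ) {n : ℕ}
    (hn : n ≠ 0) : MemLp (M.cycleIn s j) n Pr := by
  have := isProbabilityMeasure_expMeasure hμ
  have := isProbabilityMeasure_expMeasure (hl s)
  have h := (((memLp_expMeasure hμ hn).comp_fst (expMeasure (![lb, lg] s))).add
    ((memLp_expMeasure (hl s) hn).comp_snd (expMeasure μ))).comp_measurePreserving
      (hM.measurePreserving_service_waitingIn hμ hl s j)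
  refine (memLp_congr_ae (Eventually.of_forall fun ω => ?_)).1 h
  simp

lemma integral_comp_cycleIn (hμ : 0 < μ) (hl : ∀ s, 0 < ![lb, lg] s) (s : Fin 2) (j : ℕ)
    {f : ℝ → ℝ} (hf : Measurable f) : ∫ ω, f (M.cycleIn s j ω) ∂Pr =
      ∫ x : ℝ × ℝ, f (x.1 + x.2) ∂(expMeasure μ).prod (expMeasure (![lb, lg] s)) := by
  have h := hM.measurePreserving_service_waitingIn hμ hl s j
  have hf' : Measurable fun x : ℝ × ℝ => f (x.1 + x.2) :=
    hf.comp (measurable_fst.add measurable_snd)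
  rw [← h.map_eq, integral_map h.measurable.aemeasurable hf'.aestronglyMeasurable]
  simp

lemma integrable_cycleIn (hμ : 0 < μ) (hl : ∀ s, 0 < ![lb, lg] s) (s : Fin 2) (j : ℕ) :
    Integrable (M.cycleIn s j) Pr :=
  memLp_one_iff_integrable.1 (by exact_mod_cast hM.memLp_cycleIn hμ hl s j one_ne_zero)

lemma integral_cycleIn (hμ : 0 < μ) (hl : ∀ s, 0 < ![lb, lg] s) (s : Fin 2) (j : ℕ) :
    ∫ ω, M.cycleIn s j ω ∂Pr = meanCycle μ (![lb, lg] s) := by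
  have := isProbabilityMeasure_expMeasure hμ
  have := isProbabilityMeasure_expMeasure (hl s)
  rw [hM.integral_comp_cycleIn hμ hl s j measurable_id', integral_add
    ((integrable_id_expMeasure hμ).comp_fst _) ((integrable_id_expMeasure (hl s)).comp_snd _),
    integral_fun_fst (fun x : ℝ => x), integral_fun_snd (fun x : ℝ => x)]
  simp [meanCycle]

lemma integrable_cycleIn_mul_service (hμ : 0 < μ) (hl : ∀ s, 0 < ![lb, lg] s) (s : Fin 2) (j : ℕ) :
    Integrable (fun ω => M.cycleIn s j ω * M.service (j + 1) ω) Pr :=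
  (hM.indepFun_cycleIn_service_succ s j).integrable_mul (hM.integrable_cycleIn hμ hl s j)
    (hM.integrable_service hμ _)

lemma memLp_cycleIn_two (hμ : 0 < μ) (hl : ∀ s, 0 < ![lb, lg] s) (s : Fin 2) (j : ℕ) :
    MemLp (M.cycleIn s j) 2 Pr := by
  exact_mod_cast hM.memLp_cycleIn hμ hl s j two_ne_zero

lemma integrable_areaIn (hμ : 0 < μ) (hl : ∀ s, 0 < ![lb, lg] s) (s : Fin 2) (j : ℕ) :
    Integrable (M.areaIn s j) Pr :=
  ((hM.memLp_cycleIn_two hμ hl s j).integrable_sq.div_const 2).add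
    (hM.integrable_cycleIn_mul_service hμ hl s j)

lemma integral_areaIn (hμ : 0 < μ) (hl : ∀ s, 0 < ![lb, lg] s) (s : Fin 2) (j : ℕ) :
    ∫ ω, M.areaIn s j ω ∂Pr = meanArea μ (![lb, lg] s) := by
  unfold areaIn
  rw [integral_add ((hM.memLp_cycleIn_two hμ hl s j).integrable_sq.div_const 2)
      (hM.integrable_cycleIn_mul_service hμ hl s j), integral_div,
    (hM.indepFun_cycleIn_service_succ s j).integral_fun_mul_eq_mul_integral
      (hM.measurable_cycleIn s j).aestronglyMeasurable
      (hM.measurable_service _).aestronglyMeasurable,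
    hM.integral_cycleIn hμ hl, hM.integral_comp_service (j + 1) measurable_id',
    hM.integral_comp_cycleIn hμ hl s j (measurable_id'.pow_const 2)]
  simp only [meanCycle, meanArea]
  ring

end IsGilbertElliot

end SamplingSystem

namespace SamplingSystem

variable {Ω : Type*}

namespace IsGilbertElliot

variable [MeasurableSpace Ω] {Pr : Measure Ω} {p q μ lb lg : ℝ}
  {M : SamplingSystem Ω} (hM : M.IsGilbertElliot Pr p q μ lb lg)
include hM

/-! ### Averages of quantities that depend on the times -/

lemma integral_stateInd (s : Fin 2) (j : ℕ) :
    ∫ ω, M.stateInd s j ω ∂Pr = Pr.real (M.state j ⁻¹' {s}) := by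
  have : M.stateInd s j = (M.state j ⁻¹' {s}).indicator 1 := by
    ext ω
    by_cases h : M.state j ω = s <;> simp [stateInd, h]
  rw [this, integral_indicator_one (hM.measurable_state j (measurableSet_singleton s))]

lemma integral_stateInd_mul {X : Ω → ℝ} (hX : Measurable[M.timesAlgebra Set.univ] X) (s : Fin 2)
    (j : ℕ) : ∫ ω, M.stateInd s j ω * X ω ∂Pr = (∫ ω, M.stateInd s j ω ∂Pr) * ∫ ω, X ω ∂Pr := by
  have hφ : Measurable fun y : ℕ → Fin 2 => if y j = s then (1 : ℝ) else 0 :=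
    (measurable_of_countable fun i : Fin 2 => if i = s then (1 : ℝ) else 0).comp
      (measurable_pi_apply j)
  have hind : IndepFun (M.stateInd s j) X Pr := (hM.indepFun_states hX).comp hφ measurable_id
  exact hind.integral_fun_mul_eq_mul_integral (hM.measurable_stateInd s j).aestronglyMeasurable
    (hX.mono (hM.timesAlgebra_le _) le_rfl).aestronglyMeasurable

/-- State indicators preserve orthogonality: their product is a function of the chain, hence
independent of `H i * H j`, and the mean factors with a zero factor. -/
lemma ae_tendsto_average_stateInd_mul {H : ℕ → Ω → ℝ} {c : ℝ}
    (hH : ∀ i, Measurable[M.timesAlgebra Set.univ] (H i)) (hL : ∀ i, MemLp (H i) 2 Pr)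
    (horth : ∀ i j, i < j → ∫ ω, H i ω * H j ω ∂Pr = 0) (hc : ∀ i, ∫ ω, H i ω ^ 2 ∂Pr ≤ c)
    (s : Fin 2) :
    ∀ᵐ ω ∂Pr, Tendsto (fun n : ℕ => (∑ j ∈ Finset.range n, M.stateInd s j ω * H j ω) / n) atTop
      (𝓝 0) := by
  have hm : ∀ i, AEStronglyMeasurable (fun ω => M.stateInd s i ω * H i ω) Pr := fun i =>
    (hM.measurable_stateInd s i).aestronglyMeasurable.mul (hL i).aestronglyMeasurable
  have hle : ∀ i ω, ‖M.stateInd s i ω * H i ω‖ ≤ ‖H i ω‖ := fun i ω => by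
    rw [norm_mul]
    exact mul_le_of_le_one_left (norm_nonneg _) (abs_stateInd_le s i ω)
  have hL' : ∀ i, MemLp (fun ω => M.stateInd s i ω * H i ω) 2 Pr := fun i =>
    (hL i).mono (hm i) (Eventually.of_forall (hle i))
  refine ae_tendsto_average_of_orthogonal (c := c) hL' (fun i j hij => ?_) fun i => ?_
  · have hφ : Measurable fun y : ℕ → Fin 2 =>
        (if y i = s then (1 : ℝ) else 0) * (if y j = s then (1 : ℝ) else 0) :=
      have hs : Measurable fun i : Fin 2 => if i = s then (1 : ℝ) else 0 :=
        measurable_of_countable _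
      (hs.comp (measurable_pi_apply i)).mul (hs.comp (measurable_pi_apply j))
    have hX : Measurable[M.timesAlgebra Set.univ] fun ω => H i ω * H j ω := (hH i).mul (hH j)
    have hind : IndepFun (fun ω => M.stateInd s i ω * M.stateInd s j ω)
        (fun ω => H i ω * H j ω) Pr := (hM.indepFun_states hX).comp hφ measurable_id
    have := hind.integral_fun_mul_eq_mul_integral
      ((hM.measurable_stateInd s i).mul (hM.measurable_stateInd s j)).aestronglyMeasurable
      (hX.mono (hM.timesAlgebra_le _) le_rfl).aestronglyMeasurable
    rw [horth i j hij, mul_zero] at this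
    rw [← this]
    exact integral_congr_ae (Eventually.of_forall fun ω => by ring)
  · refine le_trans (integral_mono (hL' i).integrable_sq (hL i).integrable_sq fun ω => ?_) (hc i)
    exact sq_le_sq.2 (hle i ω)

/-- Disposes of the boundary terms at the `n`-th delivery; the second moments are a constant over
`n²`. -/
lemma ae_tendsto_service_div (hμ : 0 < μ) :
    ∀ᵐ ω ∂Pr, Tendsto (fun n : ℕ => M.service n ω / n) atTop (𝓝 0) ∧
      Tendsto (fun n : ℕ => M.service n ω ^ 2 / n) atTop (𝓝 0) := by
  have aux : ∀ k : ℕ, k ≠ 0 → ∀ᵐ ω ∂Pr,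
      Tendsto (fun n : ℕ => M.service n ω ^ k / n) atTop (𝓝 0) := by
    intro k hk
    have hL : ∀ n, MemLp (fun ω => M.service n ω ^ k) 2 Pr := fun n => by
      rw [memLp_two_iff_integrable_sq ((hM.measurable_service n).pow_const k).aestronglyMeasurable]
      simp_rw [← pow_mul]
      exact (hM.measurePreserving_service n).integrable_comp_of_integrable
        (integrable_pow_expMeasure hμ (k * 2))
    refine ae_tendsto_zero_of_summable_sq (fun n => ?_) ?_
    · simp_rw [div_eq_mul_inv]
      exact (hL n).mul_const _
    · have h2 : ∀ n, ∫ ω, (M.service n ω ^ k / n) ^ 2 ∂Pr =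
          (∫ x, (x ^ k) ^ 2 ∂expMeasure μ) * (1 / (n : ℝ) ^ 2) := fun n => by
        simp_rw [div_pow]
        rw [integral_div, hM.integral_comp_service n ((measurable_id'.pow_const k).pow_const 2)]
        ring
      simp_rw [h2]
      exact (Real.summable_one_div_nat_pow.2 one_lt_two).mul_left _
  filter_upwards [aux 1 one_ne_zero, aux 2 two_ne_zero] with ω h1 h2
  exact ⟨by simpa using h1, h2⟩

lemma ae_area_eq (hμ : 0 < μ) (hl : ∀ s, 0 < ![lb, lg] s) {a₀ : ℝ} (ha : 0 ≤ a₀) :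
    ∀ᵐ ω ∂Pr, ∀ j, M.area a₀ j ω = M.areaIn (M.state j ω) j ω := by
  filter_upwards [hM.ae_isRegularPath hμ hl] with ω hω j
  rw [hω.area_eq ha]; rfl

/-- The mean of a quantity that depends on the state of the cycle and on the times. -/
lemma integrable_integral_of_state {F : Fin 2 → Ω → ℝ} {X : Ω → ℝ} {m : Fin 2 → ℝ}
    (hF : ∀ s, Measurable[M.timesAlgebra Set.univ] (F s)) (hi : ∀ s, Integrable (F s) Pr)
    (hm : ∀ s, ∫ ω, F s ω ∂Pr = m s) {j : ℕ} (hX : ∀ᵐ ω ∂Pr, X ω = F (M.state j ω) ω) :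
    Integrable X Pr ∧ ∫ ω, X ω ∂Pr = ∑ s, (∫ ω, M.stateInd s j ω ∂Pr) * m s := by
  have hX' : (fun ω => ∑ s, M.stateInd s j ω * F s ω) =ᵐ[Pr] X := by
    filter_upwards [hX] with ω hω
    rw [hω, sum_stateInd_mul (fun s => F s ω)]
  have hi' : ∀ s, Integrable (fun ω => M.stateInd s j ω * F s ω) Pr := fun s =>
    (hi s).bdd_mul (hM.measurable_stateInd s j).aestronglyMeasurable
      (Eventually.of_forall fun ω => abs_stateInd_le s j ω)
  refine ⟨(integrable_finsetSum _ fun s _ => hi' s).congr hX', ?_⟩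
  rw [← integral_congr_ae hX', integral_finsetSum _ fun s _ => hi' s]
  exact Finset.sum_congr rfl fun s _ => by rw [hM.integral_stateInd_mul (hF s), hm]

/-! ### The chain of states -/

variable [IsProbabilityMeasure Pr]

lemma memLp_stateInd (s : Fin 2) (j : ℕ) : MemLp (M.stateInd s j) 2 Pr :=
  MemLp.of_bound (hM.measurable_stateInd s j).aestronglyMeasurable 1
    (Eventually.of_forall fun ω => abs_stateInd_le s j ω)

/-- The martingale property of the centred transitions. -/
lemma integral_path_mul_transition (n : ℕ) (f : (Fin (n + 1) → Fin 2) → ℝ) :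
    ∫ ω, f (fun i => M.state i ω) *
      (M.stateInd 1 (n + 1) ω - p - (1 - p - q) * M.stateInd 1 n ω) ∂Pr = 0 := by
  classical
  let A : (Fin (n + 1) → Fin 2) → Set Ω := fun s => {ω | ∀ i : Fin (n + 1), M.state i ω = s i}
  let B : (Fin (n + 1) → Fin 2) → Set Ω := fun s => A s ∩ {ω | M.state (n + 1) ω = 1}
  have hst : ∀ j s, MeasurableSet {ω | M.state j ω = s} := fun j s =>
    hM.measurable_state j (measurableSet_singleton s)
  have hA : ∀ s, MeasurableSet (A s) := fun s => by
    have : A s = ⋂ i : Fin (n + 1), {ω | M.state (i : ℕ) ω = s i} := by ext; simp [A]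
    rw [this]; exact MeasurableSet.iInter fun i => hst _ _
  have hB : ∀ s, MeasurableSet (B s) := fun s => (hA s).inter (hst _ _)
  -- The factor is the probability of moving to state `1`: it equals `p` from state `0` and `1 - q`
  -- from state `1`.
  have hstep : ∀ s, Pr.real (B s) = Pr.real (A s) * (p + (1 - p - q) * (if s (Fin.last n) = 1 then 1 else 0)) := by
    intro s
    -- The path is continued by `1`, so that its next value encodes the event that the chain moves
    -- to state `1`.
    let s' : ℕ → Fin 2 := fun i => if h : i < n + 1 then s ⟨i, h⟩ else 1
    have h1 : A s = {ω | ∀ i ≤ n, M.state i ω = s' i} := by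
      ext ω
      simp only [A, Set.mem_ofPred_eq]
      constructor
      · intro h i hi
        have := h ⟨i, Nat.lt_succ_of_le hi⟩
        simpa [s', hi] using this
      · intro h i
        have hi : (i : ℕ) ≤ n := Nat.lt_succ_iff.1 i.2
        simpa [s', hi] using h i hi
    have h2 : B s = {ω | ∀ i ≤ n + 1, M.state i ω = s' i} := by
      ext ω
      have e : s' (n + 1) = 1 := by simp [s']
      change (ω ∈ A s ∧ M.state (n + 1) ω = 1) ↔ ∀ i ≤ n + 1, M.state i ω = s' i
      rw [h1]
      constructor
      · rintro ⟨h, h'⟩ i hi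
        rcases Nat.le_succ_iff.1 hi with hi | rfl
        · exact h i hi
        · rw [h', e]
      · exact fun h => ⟨fun i hi => h i (by omega), by rw [h _ le_rfl, e]⟩
    rw [h2, hM.chain.2 n s', ← h1]
    congr 1
    have e1 : s' (n + 1) = 1 := by simp [s']
    have e0 : s' n = s (Fin.last n) := by simp [s', Fin.last]
    rw [e1, e0]
    rcases Fin.exists_fin_two.1 ⟨s (Fin.last n), rfl⟩ with h | h <;> rw [h] <;>
      simp [transitionMatrix]
    ring
  have hdec : ∀ ω, f (fun i => M.state i ω) *
      (M.stateInd 1 (n + 1) ω - p - (1 - p - q) * M.stateInd 1 n ω) =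
      ∑ s, f s * ((B s).indicator 1 ω -
        (p + (1 - p - q) * (if s (Fin.last n) = 1 then 1 else 0)) * (A s).indicator 1 ω) := by
    intro ω
    have hmem : ∀ s, ω ∈ A s ↔ (fun i : Fin (n + 1) => M.state i ω) = s := fun s =>
      ⟨fun h => funext h, fun h i => congrFun h i⟩
    rw [Finset.sum_eq_single (fun i : Fin (n + 1) => M.state i ω)]
    · have h1 : ω ∈ A fun i : Fin (n + 1) => M.state i ω := (hmem _).2 rfl
      have h2 : (B fun i : Fin (n + 1) => M.state i ω).indicator (1 : Ω → ℝ) ω =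
          M.stateInd 1 (n + 1) ω := by
        by_cases h : M.state (n + 1) ω = 1
        · rw [Set.indicator_of_mem (by exact ⟨h1, h⟩)]; simp [stateInd, h]
        · rw [Set.indicator_of_notMem (by exact fun H => h H.2)]; simp [stateInd, h]
      rw [h2, Set.indicator_of_mem h1]
      simp only [stateInd, Fin.val_last, Pi.one_apply]
      ring
    · intro s _ hs
      have h1 : ω ∉ A s := fun H => hs ((hmem s).1 H).symm
      rw [Set.indicator_of_notMem h1, Set.indicator_of_notMem (by exact fun H => h1 H.1)]
      simp
    · simp
  simp_rw [hdec]
  have hiA : ∀ s, Integrable ((A s).indicator (1 : Ω → ℝ)) Pr := fun s =>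
    (integrable_const (1 : ℝ)).indicator (hA s)
  have hiB : ∀ s, Integrable ((B s).indicator (1 : Ω → ℝ)) Pr := fun s =>
    (integrable_const (1 : ℝ)).indicator (hB s)
  have hi : ∀ s, Integrable (fun ω => f s * ((B s).indicator 1 ω -
      (p + (1 - p - q) * (if s (Fin.last n) = 1 then 1 else 0)) * (A s).indicator 1 ω)) Pr :=
    fun s => ((hiB s).sub ((hiA s).const_mul _)).const_mul _
  rw [integral_finsetSum _ fun s _ => hi s]
  refine Finset.sum_eq_zero fun s _ => ?_
  rw [integral_const_mul, integral_sub (hiB s) ((hiA s).const_mul _), integral_const_mul,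
    integral_indicator_one (hB s), integral_indicator_one (hA s), hstep s]
  ring

lemma integral_stateInd_succ (n : ℕ) : ∫ ω, M.stateInd 1 (n + 1) ω ∂Pr =
    p + (1 - p - q) * ∫ ω, M.stateInd 1 n ω ∂Pr := by
  have h := hM.integral_path_mul_transition n fun _ => 1
  have hi : ∀ j, Integrable (M.stateInd 1 j) Pr := fun j => (hM.memLp_stateInd 1 j).integrable (by simp)
  simp only [one_mul] at h
  have hi' : Integrable (fun ω => M.stateInd 1 (n + 1) ω - p) Pr := (hi _).sub (integrable_const _)
  rw [integral_sub hi' ((hi n).const_mul _),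
    integral_sub (hi _) (integrable_const _), integral_const_mul] at h
  simp only [integral_const, probReal_univ, one_smul] at h
  linarith

/-- The value `p / (p + q)` is the fixed point of the recursion `x ↦ p + (1 - p - q) x`. -/
lemma integral_stateInd_stationary (hpq : 0 < p + q)
    (h0 : Pr.real (M.state 0 ⁻¹' {0}) = q / (p + q)) (s : Fin 2) (j : ℕ) :
    ∫ ω, M.stateInd s j ω ∂Pr = ![q, p] s / (p + q) := by
  have hzero : ∀ j, ∫ ω, M.stateInd 0 j ω ∂Pr = 1 - ∫ ω, M.stateInd 1 j ω ∂Pr := by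
    intro j
    simp_rw [stateInd_zero_eq]
    rw [integral_sub (integrable_const _) ((hM.memLp_stateInd 1 j).integrable (by simp))]
    simp
  have hone : ∀ j, ∫ ω, M.stateInd 1 j ω ∂Pr = p / (p + q) := by
    intro j
    induction j with
    | zero =>
      have := hzero 0
      rw [hM.integral_stateInd, h0] at this
      have e : p / (p + q) = 1 - q / (p + q) := by field_simp; ring
      linarith
    | succ n ih => rw [hM.integral_stateInd_succ, ih]; field_simp; ring
  fin_cases s
  · change ∫ ω, M.stateInd 0 j ω ∂Pr = q / (p + q)
    rw [hzero, hone]; field_simp; ring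
  · exact hone j

/-- The ergodic theorem for the chain of states. -/
lemma ae_tendsto_average_stateInd (hp : p ∈ Set.Ioo (0 : ℝ) 1) (hq : q ∈ Set.Ioo (0 : ℝ) 1) :
    ∀ᵐ ω ∂Pr, ∀ s, Tendsto (fun n : ℕ => (∑ j ∈ Finset.range n, M.stateInd s j ω) / n) atTop
      (𝓝 (![q, p] s / (p + q))) := by
  have hpq : 0 < p + q := add_pos hp.1 hq.1
  let D : ℕ → Ω → ℝ := fun j ω => M.stateInd 1 (j + 1) ω - p - (1 - p - q) * M.stateInd 1 j ω
  have hD : ∀ j, MemLp (D j) 2 Pr := fun j =>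
    ((hM.memLp_stateInd 1 (j + 1)).sub (memLp_const p)).sub ((hM.memLp_stateInd 1 j).const_mul _)
  have hb : ∀ j ω, |D j ω| ≤ 1 := by
    intro j ω
    have h1 : M.stateInd 1 (j + 1) ω = 0 ∨ M.stateInd 1 (j + 1) ω = 1 := by
      unfold stateInd; split_ifs <;> simp
    have h2 : M.stateInd 1 j ω = 0 ∨ M.stateInd 1 j ω = 1 := by
      unfold stateInd; split_ifs <;> simp
    obtain ⟨hp0, hp1⟩ := hp
    obtain ⟨hq0, hq1⟩ := hq
    rcases h1 with h1 | h1 <;> rcases h2 with h2 | h2 <;> simp only [D, h1, h2] <;>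
      rw [abs_le] <;> constructor <;> linarith
  have hlln := ae_tendsto_average_of_orthogonal (P := Pr) (D := D) (c := 1) hD
    (fun i j hij => by
      -- For `i < j` the variable `D i` is a function of the path up to time `j`, since `i + 1 ≤ j`.
      have := hM.integral_path_mul_transition j fun s =>
        (if s ⟨i + 1, by omega⟩ = 1 then 1 else 0) - p -
          (1 - p - q) * (if s ⟨i, by omega⟩ = 1 then 1 else 0)
      exact this)
    (fun i => by
      calc ∫ ω, D i ω ^ 2 ∂Pr ≤ ∫ _, (1 : ℝ) ∂Pr :=
            integral_mono (hD i).integrable_sq (integrable_const _) fun ω => by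
              have := hb i ω
              rw [← sq_abs]
              exact pow_le_one₀ (abs_nonneg _) this
        _ = 1 := by simp)
  filter_upwards [hlln] with ω hω
  have hone : Tendsto (fun n : ℕ => (∑ j ∈ Finset.range n, M.stateInd 1 j ω) / n) atTop
      (𝓝 (p / (p + q))) := by
    -- Summing `D` telescopes to `(p + q) ∑ J - n p + (J_n - J_0)`; the last term is bounded, so the
    -- frequency of state `1` can be solved for.
    have hbd : Tendsto (fun n : ℕ => (M.stateInd 1 n ω - M.stateInd 1 0 ω) / (n : ℝ)) atTop (𝓝 0) := by
      refine squeeze_zero_norm (fun n => ?_) (tendsto_const_div_atTop_nhds_zero_nat 2)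
      rw [norm_div, Real.norm_natCast]
      gcongr
      refine (norm_sub_le _ _).trans ?_
      have h1 := abs_stateInd_le (M := M) 1 n ω
      have h2 := abs_stateInd_le (M := M) 1 0 ω
      simp only [Real.norm_eq_abs]; linarith
    have h1 := ((hω.sub hbd).add_const p).div_const (p + q)
    rw [sub_zero, zero_add] at h1
    refine h1.congr' ?_
    filter_upwards [eventually_gt_atTop 0] with n hn
    have hn' : (n : ℝ) ≠ 0 := by positivity
    have hs : ∑ j ∈ Finset.range n, M.stateInd 1 (j + 1) ω =
        ∑ j ∈ Finset.range n, M.stateInd 1 j ω + (M.stateInd 1 n ω - M.stateInd 1 0 ω) := by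
      have := Finset.sum_range_sub (fun j => M.stateInd 1 j ω) n
      rw [Finset.sum_sub_distrib] at this
      linarith
    simp only [D, Finset.sum_sub_distrib, ← Finset.mul_sum, hs, Finset.sum_const,
      Finset.card_range, nsmul_eq_mul]
    field_simp
    ring
  intro s
  fin_cases s
  · change Tendsto _ _ (𝓝 (q / (p + q)))
    have h1 := hone.const_sub 1
    have e : 1 - p / (p + q) = q / (p + q) := by field_simp; ring
    rw [e] at h1
    refine h1.congr' ?_
    filter_upwards [eventually_gt_atTop 0] with n hn
    have hn' : (n : ℝ) ≠ 0 := by positivity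
    simp only [Fin.zero_eta, stateInd_zero_eq, Finset.sum_sub_distrib, Finset.sum_const,
      Finset.card_range, nsmul_eq_mul, mul_one]
    field_simp
  · exact hone

/-! ### Laws of large numbers for the cycles and areas -/

lemma ae_tendsto_average_stateInd_mul_comp_cycleIn (hμ : 0 < μ) (hl : ∀ s, 0 < ![lb, lg] s)
    (s : Fin 2) {f : ℝ → ℝ} (hf : Measurable f)
    (hL : ∀ j, MemLp (fun ω => f (M.cycleIn s j ω)) 2 Pr) :
    ∀ᵐ ω ∂Pr, Tendsto (fun n : ℕ => (∑ j ∈ Finset.range n,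
      M.stateInd s j ω * (f (M.cycleIn s j ω) - ∫ ω, f (M.cycleIn s 0 ω) ∂Pr)) / n) atTop
      (𝓝 0) := by
  set m := ∫ ω, f (M.cycleIn s 0 ω) ∂Pr with hm
  have hmean : ∀ j, ∫ ω, f (M.cycleIn s j ω) ∂Pr = m := fun j => by
    rw [hm, hM.integral_comp_cycleIn hμ hl s j hf, hM.integral_comp_cycleIn hμ hl s 0 hf]
  have hf' : Measurable fun x => f x - m := hf.sub_const m
  have hcyc : ∀ j, Measurable[M.timesAlgebra (cycleIndices j)] (M.cycleIn s j) := fun j =>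
    measurable_cycleIn_of_subset subset_rfl s
  have hcent : ∀ j, ∫ ω, (f (M.cycleIn s j ω) - m) ∂Pr = 0 := fun j => by
    rw [integral_sub ((hL j).integrable (by simp)) (integrable_const _), hmean]
    simp
  refine hM.ae_tendsto_average_stateInd_mul (H := fun j ω => f (M.cycleIn s j ω) - m)
    (c := ∫ ω, (f (M.cycleIn s 0 ω) - m) ^ 2 ∂Pr)
    (fun j => hf'.comp (measurable_cycleIn_of_subset (Set.subset_univ _) s))
    (fun j => (hL j).sub (memLp_const m)) (fun i j hij => ?_) (fun j => ?_) s
  · have hind : IndepFun (fun ω => f (M.cycleIn s i ω) - m) (fun ω => f (M.cycleIn s j ω) - m) Pr :=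
      hM.indepFun_of_disjoint (disjoint_cycleIndices hij.ne) (hf'.comp (hcyc i)) (hf'.comp (hcyc j))
    rw [hind.integral_fun_mul_eq_mul_integral
      (hf'.comp (hM.measurable_cycleIn s i)).aestronglyMeasurable
      (hf'.comp (hM.measurable_cycleIn s j)).aestronglyMeasurable, hcent, zero_mul]
  · rw [hM.integral_comp_cycleIn hμ hl s j (hf'.pow_const 2),
      hM.integral_comp_cycleIn hμ hl s 0 (hf'.pow_const 2)]

/-- Consecutive terms are dependent, since `S_{j+1}` also enters the next cycle. They are still
orthogonal: in a product of terms `i < j`, the centred factor with `S_{j+1}` is independent of all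
the others. -/
lemma ae_tendsto_average_stateInd_mul_cycleIn_mul_service (hμ : 0 < μ) (hl : ∀ s, 0 < ![lb, lg] s)
    (s : Fin 2) :
    ∀ᵐ ω ∂Pr, Tendsto (fun n : ℕ => (∑ j ∈ Finset.range n, M.stateInd s j ω *
      (M.cycleIn s j ω * (M.service (j + 1) ω - ∫ x, x ∂expMeasure μ))) / n) atTop (𝓝 0) := by
  set m := ∫ x, x ∂expMeasure μ with hm
  have hmean : ∀ j, ∫ ω, (M.service j ω - m) ∂Pr = 0 := fun j => by
    rw [integral_sub (hM.integrable_service hμ j) (integrable_const _),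
      hM.integral_comp_service j measurable_id']
    simp [hm]
  have hS2 : ∀ j, MemLp (fun ω => M.service j ω - m) 2 Pr := fun j =>
    (show MemLp (M.service j) 2 Pr by exact_mod_cast hM.memLp_service hμ j two_ne_zero).sub
      (memLp_const m)
  have hY := fun j => hM.memLp_cycleIn_two hμ hl s j
  have hindYS : ∀ j, IndepFun (M.cycleIn s j) (fun ω => M.service (j + 1) ω - m) Pr := fun j =>
    (hM.indepFun_cycleIn_service_succ s j).comp measurable_id (measurable_id.sub_const m)
  have hsq : ∀ j, IndepFun (fun ω => M.cycleIn s j ω ^ 2)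
      (fun ω => (M.service (j + 1) ω - m) ^ 2) Pr := fun j =>
    (hindYS j).comp (measurable_id.pow_const 2) (measurable_id.pow_const 2)
  have hmeasY : ∀ (T : Set (ℕ ⊕ (Fin 2 × ℕ × ℕ))) (j : ℕ), cycleIndices j ⊆ T →
      Measurable[M.timesAlgebra T] (M.cycleIn s j) := fun T j h => measurable_cycleIn_of_subset h s
  have hmeasS : ∀ (T : Set (ℕ ⊕ (Fin 2 × ℕ × ℕ))) (j : ℕ), Sum.inl j ∈ T →
      Measurable[M.timesAlgebra T] (fun ω => M.service j ω - m) :=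
    fun T j h => (measurable_service_of_mem h).sub_const m
  refine hM.ae_tendsto_average_stateInd_mul
    (H := fun j ω => M.cycleIn s j ω * (M.service (j + 1) ω - m))
    (c := (∫ ω, M.cycleIn s 0 ω ^ 2 ∂Pr) * ∫ x, (x - m) ^ 2 ∂expMeasure μ)
    (fun j => (hmeasY _ j (Set.subset_univ _)).mul (hmeasS _ (j + 1) (Set.mem_univ _)))
    (fun j => ?_) (fun i j hij => ?_) (fun j => ?_) s
  · have hm : Measurable fun ω => M.cycleIn s j ω * (M.service (j + 1) ω - m) :=
      (hM.measurable_cycleIn s j).mul ((hM.measurable_service _).sub_const m)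
    rw [memLp_two_iff_integrable_sq hm.aestronglyMeasurable]
    simp_rw [mul_pow]
    exact (hsq j).integrable_mul (hY j).integrable_sq (hS2 (j + 1)).integrable_sq
  · have hX : Measurable[M.timesAlgebra {Sum.inl (j + 1)}ᶜ] fun ω =>
        M.cycleIn s i ω * (M.service (i + 1) ω - m) * M.cycleIn s j ω := by
      have hsub : ∀ k, k ≤ j → cycleIndices k ⊆ ({Sum.inl (j + 1)}ᶜ : Set (ℕ ⊕ (Fin 2 × ℕ × ℕ))) := by
        rintro k hk x (rfl | ⟨s, k, rfl⟩)
        · simp; omega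
        · simp
      exact ((hmeasY _ i (hsub i hij.le)).mul (hmeasS _ (i + 1) (by simp; omega))).mul
        (hmeasY _ j (hsub j le_rfl))
    have hind := hM.indepFun_of_disjoint disjoint_compl_left hX
      (hmeasS {Sum.inl (j + 1)} (j + 1) rfl)
    have := hind.integral_fun_mul_eq_mul_integral
      (hX.mono (hM.timesAlgebra_le _) le_rfl).aestronglyMeasurable
      ((hM.measurable_service _).sub_const m).aestronglyMeasurable
    rw [hmean, mul_zero] at this
    rw [← this]
    exact integral_congr_ae (Eventually.of_forall fun ω => by ring)
  · simp_rw [mul_pow]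
    rw [(hsq j).integral_fun_mul_eq_mul_integral
      ((hM.measurable_cycleIn s j).pow_const 2).aestronglyMeasurable
      (((hM.measurable_service _).sub_const m).pow_const 2).aestronglyMeasurable,
      hM.integral_comp_service (j + 1) ((measurable_id'.sub_const m).pow_const 2),
      hM.integral_comp_cycleIn hμ hl s j (measurable_id'.pow_const 2),
      hM.integral_comp_cycleIn hμ hl s 0 (measurable_id'.pow_const 2)]

lemma ae_tendsto_average_cycleIn (hp : p ∈ Set.Ioo (0 : ℝ) 1) (hq : q ∈ Set.Ioo (0 : ℝ) 1)
    (hμ : 0 < μ) (hl : ∀ s, 0 < ![lb, lg] s) :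
    ∀ᵐ ω ∂Pr, ∀ s, Tendsto (fun n : ℕ => (∑ j ∈ Finset.range n,
      M.stateInd s j ω * M.cycleIn s j ω) / n) atTop
        (𝓝 (![q, p] s / (p + q) * meanCycle μ (![lb, lg] s))) := by
  have h := fun s => hM.ae_tendsto_average_stateInd_mul_comp_cycleIn hμ hl s (f := fun x => x)
    measurable_id' fun j => hM.memLp_cycleIn_two hμ hl s j
  filter_upwards [ae_all_iff.2 h, hM.ae_tendsto_average_stateInd hp hq] with ω h1 h2 s
  have := (h1 s).add ((h2 s).mul_const (meanCycle μ (![lb, lg] s)))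
  rw [zero_add] at this
  refine this.congr fun n => ?_
  rw [hM.integral_cycleIn hμ hl, div_mul_eq_mul_div, ← add_div, Finset.sum_mul,
    ← Finset.sum_add_distrib]
  congr 1
  exact Finset.sum_congr rfl fun j _ => by ring

/-- With `m = E[S]`, the area is split as `(Y² - E[Y²]) / 2 + Y (S_{j+1} - m) + E[Y²] / 2 + m Y`.
The first two terms average to zero, and the others reduce to state frequencies and cycle averages.
Fourth moments of `Y` put `Y²` in `L²`. -/
lemma ae_tendsto_average_areaIn (hp : p ∈ Set.Ioo (0 : ℝ) 1) (hq : q ∈ Set.Ioo (0 : ℝ) 1)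
    (hμ : 0 < μ) (hl : ∀ s, 0 < ![lb, lg] s) :
    ∀ᵐ ω ∂Pr, ∀ s, Tendsto (fun n : ℕ => (∑ j ∈ Finset.range n,
      M.stateInd s j ω * M.areaIn s j ω) / n) atTop
        (𝓝 (![q, p] s / (p + q) * meanArea μ (![lb, lg] s))) := by
  have hsq : ∀ s j, MemLp (fun ω => M.cycleIn s j ω ^ 2) 2 Pr := fun s j => by
    rw [memLp_two_iff_integrable_sq ((hM.measurable_cycleIn s j).pow_const 2).aestronglyMeasurable]
    have := (hM.memLp_cycleIn hμ hl s j four_ne_zero).integrable_norm_pow four_ne_zero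
    refine this.congr (Eventually.of_forall fun ω => ?_)
    simp only [Real.norm_eq_abs, ← pow_mul]
    exact Even.pow_abs (by decide) _
  have h := fun s => hM.ae_tendsto_average_stateInd_mul_comp_cycleIn hμ hl s (f := fun x => x ^ 2)
    (measurable_id'.pow_const 2) (hsq s)
  have h' := fun s => hM.ae_tendsto_average_stateInd_mul_cycleIn_mul_service hμ hl s
  filter_upwards [ae_all_iff.2 h, ae_all_iff.2 h', hM.ae_tendsto_average_stateInd hp hq,
    hM.ae_tendsto_average_cycleIn hp hq hμ hl] with ω h1 h2 h3 h4 s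
  have hQ : meanArea μ (![lb, lg] s) = (∫ ω, M.cycleIn s 0 ω ^ 2 ∂Pr) / 2 +
      meanCycle μ (![lb, lg] s) * ∫ x, x ∂expMeasure μ := by
    rw [hM.integral_comp_cycleIn hμ hl s 0 (measurable_id'.pow_const 2)]
    simp only [meanCycle, meanArea]
    ring
  have := (((h1 s).div_const 2).add (h2 s)).add
    (((h3 s).mul_const ((∫ ω, M.cycleIn s 0 ω ^ 2 ∂Pr) / 2)).add
      ((h4 s).mul_const (∫ x, x ∂expMeasure μ)))
  rw [zero_div, zero_add, zero_add, mul_assoc, ← mul_add, ← hQ] at this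
  refine this.congr fun n => ?_
  rw [div_right_comm, div_mul_eq_mul_div, div_mul_eq_mul_div, ← add_div, ← add_div, ← add_div,
    Finset.sum_mul, Finset.sum_mul, Finset.sum_div, ← Finset.sum_add_distrib,
    ← Finset.sum_add_distrib, ← Finset.sum_add_distrib]
  congr 1
  exact Finset.sum_congr rfl fun j _ => by unfold areaIn; ring

/-! ### Conditioning on the state -/

/-- Functions of the times are independent of the state, so conditioning on it leaves their law
unchanged. -/
lemma map_cond_state {β : Type*} [MeasurableSpace β] {X : Ω → β}
    (hX : Measurable[M.timesAlgebra Set.univ] X) {s : Fin 2} {j : ℕ}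
    (h : Pr (M.state j ⁻¹' {s}) ≠ 0) : (Pr[|M.state j ⁻¹' {s}]).map X = Pr.map X := by
  have hX' : Measurable X := hX.mono (hM.timesAlgebra_le _) le_rfl
  have hs : MeasurableSet (M.state j ⁻¹' {s}) := hM.measurable_state j (measurableSet_singleton s)
  have hind : IndepFun (M.state j) X Pr :=
    (hM.indepFun_states hX).comp (measurable_pi_apply j) measurable_id
  refine Measure.ext fun B hB => ?_
  rw [Measure.map_apply hX' hB, Measure.map_apply hX' hB, cond_apply hs,
    hind.measure_inter_preimage_eq_mul _ _ (measurableSet_singleton s) hB, ← mul_assoc,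
    ENNReal.inv_mul_cancel h (measure_ne_top _ _), one_mul]

lemma integrable_integral_cond_state {X : Ω → ℝ} (hX : Measurable[M.timesAlgebra Set.univ] X)
    (hi : Integrable X Pr) {s : Fin 2} {j : ℕ} (h : Pr (M.state j ⁻¹' {s}) ≠ 0) :
    Integrable X Pr[|M.state j ⁻¹' {s}] ∧
      ∫ ω, X ω ∂Pr[|M.state j ⁻¹' {s}] = ∫ ω, X ω ∂Pr := by
  have hX' : Measurable X := hX.mono (hM.timesAlgebra_le _) le_rfl
  have hmap := hM.map_cond_state hX h
  constructor
  · have : Integrable (fun x : ℝ => x) (Pr.map X) :=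
      (integrable_map_measure measurable_id'.aestronglyMeasurable hX'.aemeasurable).2 hi
    rw [← hmap, integrable_map_measure measurable_id'.aestronglyMeasurable hX'.aemeasurable] at this
    exact this
  · rw [← integral_map (f := fun x => x) hX'.aemeasurable measurable_id'.aestronglyMeasurable, hmap,
      integral_map hX'.aemeasurable measurable_id'.aestronglyMeasurable]

end IsGilbertElliot

end SamplingSystem

lemma meanCycle_pos {μ l : ℝ} (hμ : 0 < μ) (hl : 0 < l) : 0 < meanCycle μ l :=
  add_pos (integral_expMeasure_pos hμ) (integral_expMeasure_pos hl)

end GilbertElliot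

/-! ### Assembly of the three claims -/

open GilbertElliot SamplingSystem IsGilbertElliot in
theorem mainTheorem2 {Ω : Type*} [MeasurableSpace Ω] (Pr : Measure Ω) [IsProbabilityMeasure Pr]
    (p q μ lb lg a₀ : ℝ) (hp : p ∈ Set.Ioo (0 : ℝ) 1) (hq : q ∈ Set.Ioo (0 : ℝ) 1)
    (hμ : 0 < μ) (hlb : 0 < lb) (hlg : lb < lg) (ha₀ : 0 ≤ a₀)
    (M : GilbertElliot.SamplingSystem Ω) (hM : M.IsGilbertElliot Pr p q μ lb lg) :
    -- the time average of the age, and the ratio of the average area to the average cycle length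
    (∀ᵐ ω ∂Pr,
      (∀ τ : ℝ, 0 ≤ τ → IntervalIntegrable (fun t => M.age a₀ t ω) volume 0 τ) ∧
      Tendsto (fun τ : ℝ => (1 / τ) * ∫ t in (0 : ℝ)..τ, M.age a₀ t ω) atTop
        (𝓝 (GilbertElliot.averageAge p q μ lb lg)) ∧
      Tendsto (fun n : ℕ => ((1 / (n : ℝ)) * ∑ j ∈ Finset.range n, M.area a₀ j ω) /
          ((1 / (n : ℝ)) * ∑ j ∈ Finset.range n, M.cycle j ω)) atTop
        (𝓝 (GilbertElliot.averageAge p q μ lb lg))) ∧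
    -- per-state laws and moments
    (∀ (j : ℕ) (s : Fin 2), Pr (M.state j ⁻¹' {s}) ≠ 0 →
      (Pr[|M.state j ⁻¹' {s}]).map (fun ω => (M.service j ω, M.waiting j ω)) =
        (expMeasure μ).prod (expMeasure (![lb, lg] s)) ∧
      Integrable (M.cycle j) Pr[|M.state j ⁻¹' {s}] ∧
      ∫ ω, M.cycle j ω ∂Pr[|M.state j ⁻¹' {s}] = GilbertElliot.meanCycle μ (![lb, lg] s) ∧
      Integrable (M.area a₀ j) Pr[|M.state j ⁻¹' {s}] ∧
      ∫ ω, M.area a₀ j ω ∂Pr[|M.state j ⁻¹' {s}] = GilbertElliot.meanArea μ (![lb, lg] s)) ∧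
    -- the ratio of expectations, for the stationary chain
    (Pr.real (M.state 0 ⁻¹' {0}) = q / (p + q) → ∀ j : ℕ,
      Integrable (M.cycle j) Pr ∧ Integrable (M.area a₀ j) Pr ∧
      (∫ ω, M.area a₀ j ω ∂Pr) / (∫ ω, M.cycle j ω ∂Pr) =
        GilbertElliot.averageAge p q μ lb lg) := by
  have hl : ∀ s, 0 < ![lb, lg] s := Fin.forall_fin_two.2 ⟨hlb, hlb.trans hlg⟩
  have hpq : 0 < p + q := add_pos hp.1 hq.1
  have hmb := meanCycle_pos hμ hlb
  have hmg := meanCycle_pos hμ (hlb.trans hlg)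
  have hp0 := hp.1
  have hq0 := hq.1
  -- Means under the stationary weights. They serve both as almost sure limits for any initial law
  -- and as expectations for the stationary chain; the factor `1 / (p + q)` cancels in their ratio.
  let mY : ℝ := ∑ s, ![q, p] s / (p + q) * meanCycle μ (![lb, lg] s)
  let mQ : ℝ := ∑ s, ![q, p] s / (p + q) * meanArea μ (![lb, lg] s)
  have hmYeq : mY = (q * meanCycle μ lb + p * meanCycle μ lg) / (p + q) := by
    simp only [mY, Fin.sum_univ_two, Matrix.cons_val_zero, Matrix.cons_val_one]
    ring
  have hmQeq : mQ = (q * meanArea μ lb + p * meanArea μ lg) / (p + q) := by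
    simp only [mQ, Fin.sum_univ_two, Matrix.cons_val_zero, Matrix.cons_val_one]
    ring
  have hmY : 0 < mY := by rw [hmYeq]; positivity
  have hratio : mQ / mY = averageAge p q μ lb lg := by
    rw [hmYeq, hmQeq, div_div_div_cancel_right₀ hpq.ne']; rfl
  have hareaEq := hM.ae_area_eq hμ hl ha₀
  refine ⟨?_, fun j s hs => ?_, fun h0 j => ?_⟩
  · filter_upwards [hM.ae_isRegularPath hμ hl, hareaEq, hM.ae_tendsto_average_cycleIn hp hq hμ hl,
      hM.ae_tendsto_average_areaIn hp hq hμ hl, hM.ae_tendsto_service_div hμ] with ω hω hA hY hQ hS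
    have hY' : Tendsto (fun n : ℕ => (∑ j ∈ Finset.range n, M.cycle j ω) / n) atTop (𝓝 mY) := by
      refine (tendsto_finsetSum Finset.univ fun s _ => hY s).congr fun n => ?_
      rw [← Finset.sum_div, Finset.sum_comm]
      congr 1
      exact Finset.sum_congr rfl fun j _ => by
        rw [sum_stateInd_mul (fun s => M.cycleIn s j ω), cycle_eq_cycleIn]
    have hQ' : Tendsto (fun n : ℕ => (∑ j ∈ Finset.range n, M.area a₀ j ω) / n) atTop (𝓝 mQ) := by
      refine (tendsto_finsetSum Finset.univ fun s _ => hQ s).congr fun n => ?_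
      rw [← Finset.sum_div, Finset.sum_comm]
      congr 1
      exact Finset.sum_congr rfl fun j _ => by
        rw [sum_stateInd_mul (fun s => M.areaIn s j ω), hA]
    rw [← hratio]
    exact ⟨fun τ _ => hω.intervalIntegrable_age a₀ 0 τ,
      hω.tendsto_timeAverage ha₀ hmY hY' hQ' hS.1 hS.2,
      tendsto_average_div_average hmY hY' hQ'⟩
  · have hmem : ∀ᵐ ω ∂Pr[|M.state j ⁻¹' {s}], M.state j ω = s :=
      ae_cond_mem (hM.measurable_state j (measurableSet_singleton s))
    have hcyc : M.cycleIn s j =ᵐ[Pr[|M.state j ⁻¹' {s}]] M.cycle j := by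
      filter_upwards [hmem] with ω hω
      rw [cycle_eq_cycleIn, hω]
    have harea : M.areaIn s j =ᵐ[Pr[|M.state j ⁻¹' {s}]] M.area a₀ j := by
      filter_upwards [hmem, cond_absolutelyContinuous.ae_le hareaEq] with ω hω h
      rw [h j, hω]
    obtain ⟨hY1, hY2⟩ := hM.integrable_integral_cond_state (measurable_cycleIn_univ s j)
      (hM.integrable_cycleIn hμ hl s j) hs
    obtain ⟨hQ1, hQ2⟩ := hM.integrable_integral_cond_state (measurable_areaIn_univ s j)
      (hM.integrable_areaIn hμ hl s j) hs
    refine ⟨?_, hY1.congr hcyc, ?_, hQ1.congr harea, ?_⟩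
    · have hS : Measurable[M.timesAlgebra Set.univ] (M.service j) :=
        measurable_service_of_mem (Set.mem_univ _)
      have hX : Measurable[M.timesAlgebra Set.univ] fun ω =>
          (M.service j ω, M.cycleIn s j ω - M.service j ω) :=
        hS.prodMk ((measurable_cycleIn_univ s j).sub hS)
      rw [← hM.map_service_waitingIn hμ hl s j, ← hM.map_cond_state hX hs]
      refine Measure.map_congr ?_
      filter_upwards [hcyc] with ω hω
      rw [waiting, hω]
    · rw [← integral_congr_ae hcyc, hY2, hM.integral_cycleIn hμ hl]
    · rw [← integral_congr_ae harea, hQ2, hM.integral_areaIn hμ hl]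
  · obtain ⟨hY1, hY2⟩ := hM.integrable_integral_of_state (j := j) (X := M.cycle j)
      (fun s => measurable_cycleIn_univ s j) (fun s => hM.integrable_cycleIn hμ hl s j)
      (fun s => hM.integral_cycleIn hμ hl s j) (Eventually.of_forall fun ω => cycle_eq_cycleIn j ω)
    obtain ⟨hQ1, hQ2⟩ := hM.integrable_integral_of_state (j := j) (X := M.area a₀ j)
      (fun s => measurable_areaIn_univ s j) (fun s => hM.integrable_areaIn hμ hl s j)
      (fun s => hM.integral_areaIn hμ hl s j) (hareaEq.mono fun ω h => h j)
    refine ⟨hY1, hQ1, ?_⟩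
    rw [hY2, hQ2, ← hratio]
    simp_rw [hM.integral_stateInd_stationary hpq h0]
    rfl
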